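/- Let $d\ge 2$. Let $\mathbb{Z}^d_\boxtimes$ be the graph on $\mathbb{Z}^d$ in which two different vertices $u,v$ are adjacent if $\sum_{i}|u_i-v_i|\le 2$, and for $1\le \ell\le d$ let $\mathrm{PM}^{d,\ell}_\boxtimes$ be the locally checkable problem (LCL) on $\mathbb{Z}^d$ of finding, in every $\ell$-dimensional sub-grid of $\mathbb{Z}^d$ obtained by fixing the last $d-\ell$ coordinates, a perfect matching of the copy of $\mathbb{Z}^\ell_\boxtimes$ on this sub-grid; every vertex outputs the direction of the vertex with which it is matched. Put $\mathrm{PM}^d_\boxtimes=\mathrm{PM}^{d,d}_\boxtimes$. An LCL $\Pi$ is in $\mathsf{LOCAL}(O(\log^* n))$ if there are $f(n)=O(\log^* n)$ and a deterministic rule that, for all large $n$, for every oriented $d$-dimensional torus with $n$ vertices and side lengths $\Theta(n^{1/d})$ and every assignment of unique identifiers from $\{1,\dots,n^{O(1)}\}$, computes the output of each vertex from $n$ and the identifiers within distance $f(n)$, so that the outputs solve $\Pi$ on the torus. A uniform local algorithm on $\mathbb{Z}^d$ is a measurable partial function on finite balls of the grid labelled by $[0,1]$; run at a vertex of $\mathbb{Z}^d$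 with i.i.d. uniform labels, it inspects balls of growing radius around the vertex until it can output, and the radius at which it stops is its coding radius $R$. It solves $\Pi$ if almost surely it stops at every vertex and its outputs solve $\Pi$. It has uniform complexity $t(\varepsilon)$ if $\mathbb{P}(R>t(\varepsilon))\le\varepsilon$ for all sufficiently small $\varepsilon>0$; $\mathsf{ULOCAL}(t(\varepsilon))$ is the class of LCLs solved by such an algorithm. Let ${\bf M}(\Pi)\in[0,\infty]$ be the supremum of the $\alpha\in[0,\infty)$ for which some uniform local algorithm solving $\Pi$ has $\mathbb{E}(R^\alpha)<\infty$. Then: 1. $\mathrm{PM}^d_\boxtimes\notin\mathsf{LOCAL}(O(\log^* n))$ (for every choice of the constants implied in $\Theta(n^{1/d})$ and $n^{O(1)}$, in particular for tori with all sides equal and identifiers from $\{1,\dots,n\}$), and $\mathrm{PM}^d_\boxtimes\notin\mathsf{ULOCAL}\big(o(\sqrt[d-1]{1/\varepsilon})\big)$. 2. $\mathrm{PM}^d_\boxtimes$ can be solved by a uniform local algorithm of uniform complexity $\sqrt[d-1]{1/\varepsilon}\cdot 2^{O(\sqrt{\log 1/\varepsilon})}$. 3. For every $1\le j\le d-1$,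 the problem $\mathrm{PM}^{d,j+1}_\boxtimes$ can be solved by a uniform local algorithm of uniform complexity $\sqrt[j-o(1)]{1/\varepsilon}$ (with $o(1)\to0$ as $\varepsilon\to 0$), it is not in $\mathsf{ULOCAL}\big(o(\sqrt[j]{1/\varepsilon})\big)$, and ${\bf M}(\mathrm{PM}^{d,j+1}_\boxtimes)=j$. -/

import Mathlib

open MeasureTheory Filter Topology Asymptotics
open scoped ENNReal NNReal

/-! ### Grids, balls, locally checkable problems -/

/-- The vertex set of the grid `ℤ^d`. -/
abbrev Site (d : ℕ) : Type := Fin d → ℤ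

/-- The `ℓ¹`-length, i.e. the distance to the origin in the Cayley graph of `ℤ^d` with respect
to the standard generators. -/
def l1 {d : ℕ} (x : Site d) : ℕ := ∑ i, (x i).natAbs

/-- The ball of radius `r` around the origin in the Cayley graph of `ℤ^d`. -/
abbrev Ball (d r : ℕ) : Type := {x : Site d // l1 x ≤ r}

/-- The centre of a ball. -/
def Ball.origin (d r : ℕ) : Ball d r := ⟨0, by simp [l1]⟩

/-- The `r`-hop neighbourhood of the vertex `v`, labelled by `c`, in a graph `G` that is a quotient
of the oriented labelled grid `ℤ^d` through `π`. (For `ℤ^d` itself `π = id`, for a torus `π` is the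
reduction of the coordinates; if the torus is wide enough, this is exactly the labelled ball
around `v`.) -/
def nbhd {d : ℕ} {G α : Type} [Add G] (π : Site d → G) (c : G → α) (v : G) (r : ℕ) :
    Ball d r → α :=
  fun y => c (v + π y.1)

/-- A locally checkable problem (without inputs) on `ℤ^d` with the finite set `Out` of output
labels: a radius and the set of allowed labelled balls of that radius. -/
structure LCL (d : ℕ) (Out : Type) [Finite Out] where
  radius : ℕ
  allowed : Set (Ball d radius → Out)

/-- `c` is a correct solution on the graph `G`: every neighbourhood is allowed. -/
def LCL.IsColoring {d : ℕ} {Out : Type} [Finite Out] (P : LCL d Out) {G : Type} [Add G]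
    (π : Site d → G) (c : G → Out) : Prop :=
  ∀ v : G, nbhd π c v P.radius ∈ P.allowed

/-! ### Deterministic local algorithms on tori -/

/-- The iterated logarithm: the number of times that `log₂` has to be applied to `n` until the
result is at most `1`. -/
noncomputable def logStar (n : ℕ) : ℕ := sInf {k : ℕ | (Real.logb 2)^[k] (n : ℝ) ≤ 1}

/-- The `d`-dimensional torus with side lengths `m`. -/
abbrev Torus {d : ℕ} (m : Fin d → ℕ) : Type := (i : Fin d) → ZMod (m i)

/-- Reduction of the coordinates. -/
def torusProj {d : ℕ} (m : Fin d → ℕ) (x : Site d) : Torus m := fun i => (x i : ZMod (m i))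

/-- All sides of the torus are between `n^{1/d} / K` and `K n^{1/d}`, where `n` is the number of
its vertices. For `K = 1` these are the tori with all sides equal. -/
def BalancedSides {d : ℕ} (K : ℝ) (n : ℕ) (m : Fin d → ℕ) : Prop :=
  ∀ i, (n : ℝ) ^ (1 / (d : ℝ)) / K ≤ (m i : ℝ) ∧ (m i : ℝ) ≤ K * (n : ℝ) ^ (1 / (d : ℝ))

/-- A deterministic local algorithm of local complexity `f`: given the number `n` of vertices and
the ball of radius `f n`, labelled by identifiers, it returns an output label. -/
def LocalAlgorithm (d : ℕ) (Out : Type) (f : ℕ → ℕ) : Type :=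
  (n : ℕ) → (Ball d (f n) → ℕ) → Out

/-- The algorithm solves the problem on all (large enough) tori with side lengths `Θ(n^{1/d})`,
with implied constant `K`, for all assignments of unique identifiers from `{1, …, n^c}`. -/
def LocalAlgorithm.Solves {d : ℕ} {Out : Type} [Finite Out] {f : ℕ → ℕ}
    (A : LocalAlgorithm d Out f) (P : LCL d Out) (K : ℝ) (c : ℕ) : Prop :=
  ∀ᶠ n : ℕ in atTop, ∀ m : Fin d → ℕ, (∀ i, 0 < m i) → ∏ i, m i = n → BalancedSides K n m →
    ∀ ident : Torus m → ℕ, Function.Injective ident → (∀ v, 1 ≤ ident v ∧ ident v ≤ n ^ c) →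
      P.IsColoring (torusProj m) (fun v => A n (nbhd (torusProj m) ident v (f n)))

/-- The class `LOCAL(O(g))`, for tori with side lengths `Θ(n^{1/d})` with implied constant `K`, and
identifiers from `{1, …, n^c}`. -/
def InLOCAL {d : ℕ} {Out : Type} [Finite Out] (P : LCL d Out) (K : ℝ) (c : ℕ) (g : ℕ → ℕ) :
    Prop :=
  ∃ f : ℕ → ℕ, (fun n => (f n : ℝ)) =O[atTop] (fun n => (g n : ℝ)) ∧
    ∃ A : LocalAlgorithm d Out f, A.Solves P K c

/-! ### Uniform local algorithms -/

/-- Labellings of `ℤ^d` by elements of `[0,1]`. -/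
abbrev RandomLabels (d : ℕ) : Type := Site d → unitInterval

/-- The law of an independent, uniformly distributed labelling of `ℤ^d`. -/
noncomputable def iid (d : ℕ) : Measure (RandomLabels d) :=
  Measure.infinitePi (fun _ : Site d => (volume : Measure unitInterval))

/-- A uniform local algorithm: a measurable partial function on balls labelled by `[0,1]`. The
value `none` means that the ball is not in the domain, so that the vertex has to look further. -/
structure UniformAlgorithm (d : ℕ) (Out : Type) where
  rule : (r : ℕ) → (Ball d r → unitInterval) → Option Out
  measurable_rule : ∀ r o, MeasurableSet {y | rule r y = o}

/-- The coding radius at `v`: the least radius at which the algorithm returns an output, and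
`∞` if there is none. -/
noncomputable def UniformAlgorithm.codingRadius {d : ℕ} {Out : Type} (A : UniformAlgorithm d Out)
    (x : RandomLabels d) (v : Site d) : ℕ∞ :=
  ⨅ (r : ℕ) (_ : A.rule r (nbhd id x v r) ≠ none), (r : ℕ∞)

/-- On the labelling `x` the algorithm stops at the vertex `v` and returns `o`. -/
def UniformAlgorithm.Outputs {d : ℕ} {Out : Type} (A : UniformAlgorithm d Out)
    (x : RandomLabels d) (v : Site d) (o : Out) : Prop :=
  ∃ r : ℕ, A.codingRadius x v = r ∧ A.rule r (nbhd id x v r) = some o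

/-- With probability one, the algorithm stops at every vertex and its outputs form a correct
solution. -/
def UniformAlgorithm.Solves {d : ℕ} {Out : Type} [Finite Out] (A : UniformAlgorithm d Out)
    (P : LCL d Out) : Prop :=
  ∀ᵐ x ∂(iid d), ∃ c : Site d → Out, (∀ v, A.Outputs x v (c v)) ∧ P.IsColoring id c

/-- The algorithm has uniform complexity `t`: the probability that the coding radius at a vertex
exceeds `t ε` is at most `ε` (for all small `ε > 0`). The probability does not depend on the vertex,
so the origin is used. -/
def UniformAlgorithm.HasComplexity {d : ℕ} {Out : Type} (A : UniformAlgorithm d Out)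
    (t : ℝ → ℝ) : Prop :=
  ∀ᶠ ε in 𝓝[>] (0 : ℝ),
    iid d {x | ENNReal.ofReal (t ε) < (A.codingRadius x 0 : ℝ≥0∞)} ≤ ENNReal.ofReal ε

/-- The class `ULOCAL(t)`. -/
def InULOCAL {d : ℕ} {Out : Type} [Finite Out] (P : LCL d Out) (t : ℝ → ℝ) : Prop :=
  ∃ A : UniformAlgorithm d Out, A.Solves P ∧ A.HasComplexity t

/-- The class `ULOCAL(o(t))`. -/
def InULOCALLittleO {d : ℕ} {Out : Type} [Finite Out] (P : LCL d Out) (t : ℝ → ℝ) : Prop :=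
  ∃ s : ℝ → ℝ, s =o[𝓝[>] (0 : ℝ)] t ∧ InULOCAL P s

/-- The `α`-moment of the coding radius, `∑ r^α P(R = r)` (the coding radius of an algorithm that
solves a problem is finite almost surely). -/
noncomputable def UniformAlgorithm.moment {d : ℕ} {Out : Type} (A : UniformAlgorithm d Out)
    (α : ℝ≥0) : ℝ≥0∞ :=
  ∑' r : ℕ, (r : ℝ≥0∞) ^ (α : ℝ) * iid d {x | A.codingRadius x 0 = r}

/-- The invariant `M(P) ∈ [0,∞]`: the supremum of all `α ∈ [0,∞)` such that some uniform local
algorithm solves `P` and its coding radius has finite `α`-moment. -/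
noncomputable def momentExponent {d : ℕ} {Out : Type} [Finite Out] (P : LCL d Out) : ℝ≥0∞ :=
  ⨆ (α : ℝ≥0) (_ : ∃ A : UniformAlgorithm d Out, A.Solves P ∧ A.moment α < ∞), (α : ℝ≥0∞)

/-! ### Perfect matchings in the grid with diagonal edges -/

/-- The grid with added diagonal edges: two different vertices are adjacent if their `ℓ¹`-distance
is at most `2`. -/
def diagGrid (d : ℕ) : SimpleGraph (Site d) where
  Adj u v := u ≠ v ∧ ∑ i, |u i - v i| ≤ 2
  symm := ⟨fun u v h => ⟨h.1.symm, by simpa only [abs_sub_comm] using h.2⟩⟩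
  loopless := ⟨fun _ h => h.1 rfl⟩

/-- The disjoint union of the grids with added diagonal edges on all the `l`-dimensional sub-grids
of `ℤ^d` in the directions of the first `l` coordinates. -/
def layerGrid (d l : ℕ) : SimpleGraph (Site d) where
  Adj u v := (diagGrid d).Adj u v ∧ ∀ i : Fin d, l ≤ i.val → u i = v i
  symm := ⟨fun _ _ h => ⟨h.1.symm, fun i hi => (h.2 i hi).symm⟩⟩
  loopless := ⟨fun _ h => h.1.1 rfl⟩

/-- The vectors from a vertex to its neighbours in `layerGrid d l`. -/
abbrev Direction (d l : ℕ) : Type := {s : Site d // (layerGrid d l).Adj 0 s}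

lemma Direction.l1_le {d l : ℕ} (s : Direction d l) : l1 s.1 ≤ 2 := by
  have h := s.2.1.2
  simp only [Pi.zero_apply, zero_sub, abs_neg] at h
  unfold l1
  zify
  exact h

instance (d l : ℕ) : Finite (Direction d l) := by
  have h : Set.Finite {s : Site d | (layerGrid d l).Adj 0 s} := by
    apply (Set.finite_Icc (fun _ => (-2 : ℤ) : Site d) (fun _ => 2)).subset
    intro s hs
    have hl : l1 s ≤ 2 := Direction.l1_le (⟨s, hs⟩ : Direction d l)
    have hi : ∀ i, (s i).natAbs ≤ 2 := fun i =>
      (Finset.single_le_sum (f := fun i => (s i).natAbs) (fun _ _ => Nat.zero_le _)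
        (Finset.mem_univ i)).trans hl
    constructor
    · intro i
      have := hi i
      show (-2 : ℤ) ≤ s i
      omega
    · intro i
      have := hi i
      show s i ≤ 2
      omega
  exact h.to_subtype

/-- The end of the direction `s`, as an element of the ball of radius `2`. -/
def Direction.toBall {d l : ℕ} (s : Direction d l) : Ball d 2 := ⟨s.1, s.l1_le⟩

/-- The problem of finding a perfect matching in each of the `l`-dimensional sub-grids (with added
diagonal edges) given by the first `l` coordinates. Every vertex outputs the direction of the
vertex with which it is matched, and that vertex has to output the opposite direction. -/
def subgridMatching (d l : ℕ) : LCL d (Direction d l) where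
  radius := 2
  allowed := {p | (p (p (Ball.origin d 2)).toBall).1 = -(p (Ball.origin d 2)).1}

/-- The perfect matching problem in `ℤ^d` with added diagonal edges. -/
abbrev diagMatching (d : ℕ) : LCL d (Direction d d) := subgridMatching d d

/-- If `l = d`, there is one sub-grid, the whole grid. -/
lemma layerGrid_self (d : ℕ) : layerGrid d d = diagGrid d := by
  ext u v
  exact ⟨fun h => h.1, fun h => ⟨h, fun i hi => absurd i.2 (not_lt.mpr hi)⟩⟩

/-- The solutions of `subgridMatching d l` are the perfect matchings of `layerGrid d l`. -/
lemma subgridMatching_isColoring_iff {d l : ℕ} (c : Site d → Direction d l) :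
    (subgridMatching d l).IsColoring id c ↔
      ∃ M : (layerGrid d l).Subgraph, M.IsPerfectMatching ∧ ∀ v, M.Adj v (v + (c v).1) := by
  have key : (subgridMatching d l).IsColoring id c ↔ ∀ v, (c (v + (c v).1)).1 = -(c v).1 := by
    refine forall_congr' fun v => ?_
    show (c (v + (c (v + 0)).1)).1 = -(c (v + 0)).1 ↔ _
    rw [add_zero]
  rw [key]
  constructor
  · intro h
    have hadj : ∀ v, (layerGrid d l).Adj v (v + (c v).1) := by
      intro v
      obtain ⟨⟨h1, h2⟩, h3⟩ := (c v).2
      refine ⟨⟨fun e => h1 ?_, ?_⟩, fun i hi => ?_⟩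
      · exact (left_eq_add.mp e).symm
      · simpa using h2
      · simpa using (h3 i hi).symm
    refine ⟨{ verts := Set.univ
              Adj := fun u v => v = u + (c u).1
              adj_sub := ?_
              edge_vert := fun _ => Set.mem_univ _
              symm := ⟨?_⟩ }, ?_, fun _ => rfl⟩
    · rintro u v rfl
      exact hadj u
    · rintro u v rfl
      rw [h]
      simp
    · rw [SimpleGraph.Subgraph.isPerfectMatching_iff]
      intro v
      exact ⟨v + (c v).1, rfl, fun _ hy => hy⟩
  · rintro ⟨M, hM, hc⟩ v
    rw [SimpleGraph.Subgraph.isPerfectMatching_iff] at hM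
    have := (hM (v + (c v).1)).unique (hc _) (hc v).symm
    rw [add_assoc, add_eq_left] at this
    exact (neg_eq_of_add_eq_zero_right this).symm

/-!
**Deterministic local algorithms.** Partners output opposite directions, so a solution on a torus
gives an involution of its vertices without fixed points. There is none on a torus with an odd
number of vertices (`not_inLOCAL_diagMatching`).

**Lower bound for uniform local algorithms.** In a layer of dimension `l = j + 1`, take a cube of
odd side `N`. The vertices with partners inside the cube come in pairs, so the number of vertices
with partners outside is odd. It is determined by the outputs of the `O(N^j)` vertices within
distance `2` of the boundary. Suppose that `R > N / 4` has probability less than a small multiple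
of `N^(-j)`. Then with large probability these vertices stop within radius `N / 4`, and the odd
number is found from the labels in a window of side less than `3 N`. Such a window embeds into the
torus of side `3 N` with i.i.d. labels, which is tiled by `3^l` translates of the cube. So with
positive probability all `3^l` cubes have an odd number of vertices with partners outside. But these
vertices are matched with each other, so their total number is even, while `3^l` is odd
(`not_forall_oddBoundary`, `one_le_card_mul_iid`,
`not_inULOCALLittleO_subgridMatching`).

**Upper bound.** If every vertex of a forest has finitely many descendants, then the vertices can be
matched within distance `2`, bottom up: a vertex with an odd number of descendants (itself included)
is left over by its descendants and is matched around its parent, namely with a sibling that is left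
over too or with the parent. The others are matched around themselves (`host`,
`even_ncard_host_fiber`, `matchVec_spec`). How a vertex is matched depends on its descendants and
those of its neighbours, so what is needed is a forest in which it is unlikely to have descendants
far away.

The forest is built along the scales `2^(k²)`. The labels provide random marks such that a mark is
at least `k` with probability `2^(-d k (k - 1))`. This is slightly more than `2^(-d k²)`, so that
holes of radius `2^(k²) / 2` without such marks are very rare (`eventually_iid_hole_le`). The hubs
of level `k` are essentially the sites with these marks. They are joined to the hubs within distance
`O(2^(k²))` by paths of length `2^(k² + O(k))`, which consist of paths of level `k - 1`
(`hubPath_walk`). The union of these paths is the skeleton of level `k`. The skeletons are nested,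
and every vertex of the skeleton of level `k` is joined inside of it to the skeleton of level
`k + 1` by a walk of length `O(pathLen (k + 1))`. The parent of a vertex is the next vertex on a
shortest such walk, so a chain of ancestors that has not reached the skeleton of level `k` has
length at most `4 * pathLen k` (`length_le_of_iterate_parent`). Hence a vertex that, together with
its neighbours, is outside the skeleton of level `k` knows its partner from the marks within
distance `18 * pathLen k` (`Agree.matchVec_eq`).

A box of side `2^(k²)` contains `2^O(k)` hubs of level `k` on average, each with `2^O(k)` paths of
length `2^(k² + O(k))`. So the density of the skeleton is `2^(-(d - 1) k² + O(k))`
(`exists_iid_skeleton_le`), and this bounds the probability of `R > 18 * pathLen k`. With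
`k ≈ √(log (1/ε) / (d - 1))` this is the uniform complexity
`(1/ε)^(1/(d - 1)) 2^O(√(log (1/ε)))` (`exists_hasComplexity`). The same algorithm solves the
problem in every layer (`exists_layer_algorithm`).

**Moments.** The tails of the algorithm give all moments of order less than `j` (`moment_lt_top`).
Conversely, by Markov's inequality a finite moment of order greater than `j` would give a uniform
complexity that contradicts the lower bound (`hasComplexity_of_moment`).
-/

/-! ### The `ℓ¹`-length -/

@[simp] lemma l1_zero {d : ℕ} : l1 (0 : Site d) = 0 := by simp [l1]

lemma l1_neg {d : ℕ} (x : Site d) : l1 (-x) = l1 x := by simp [l1]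

lemma l1_sub_comm {d : ℕ} (x y : Site d) : l1 (x - y) = l1 (y - x) := by
  rw [← l1_neg, neg_sub]

lemma l1_add_le {d : ℕ} (x y : Site d) : l1 (x + y) ≤ l1 x + l1 y := by
  unfold l1
  rw [← Finset.sum_add_distrib]
  exact Finset.sum_le_sum fun i _ => Int.natAbs_add_le _ _

lemma l1_sub_le {d : ℕ} (x y z : Site d) : l1 (x - z) ≤ l1 (x - y) + l1 (y - z) := by
  have := l1_add_le (x - y) (y - z)
  rwa [sub_add_sub_cancel] at this

lemma natAbs_le_l1 {d : ℕ} (x : Site d) (i : Fin d) : (x i).natAbs ≤ l1 x :=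
  Finset.single_le_sum (f := fun i => (x i).natAbs) (fun _ _ => Nat.zero_le _) (Finset.mem_univ i)

lemma l1_eq_zero {d : ℕ} {x : Site d} : l1 x = 0 ↔ x = 0 := by
  simp [l1, funext_iff]

lemma l1_single {d : ℕ} (i : Fin d) (a : ℤ) : l1 (Pi.single i a : Site d) = a.natAbs := by
  unfold l1
  rw [Finset.sum_eq_single i]
  · simp
  · intro j _ hj
    simp [Pi.single_eq_of_ne hj]
  · simp

lemma finite_l1_le (d r : ℕ) : {x : Site d | l1 x ≤ r}.Finite := by
  refine (Set.finite_Icc (fun _ => -(r : ℤ) : Site d) (fun _ => r)).subset fun x hx => ?_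
  have := fun i => (natAbs_le_l1 x i).trans hx
  exact ⟨fun i => by have := this i; simp only; omega, fun i => by have := this i; simp only; omega⟩

instance (d r : ℕ) : Finite (Ball d r) := (finite_l1_le d r).to_subtype

/-- The ball of radius `r` around the origin, as a finite set of sites. -/
noncomputable def l1Ball (d r : ℕ) : Finset (Site d) := (finite_l1_le d r).toFinset

@[simp] lemma mem_l1Ball {d r : ℕ} {x : Site d} : x ∈ l1Ball d r ↔ l1 x ≤ r := by simp [l1Ball]

lemma card_l1Ball_le (d r : ℕ) : (l1Ball d r).card ≤ (2 * r + 1) ^ d := by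
  have : l1Ball d r ⊆ Fintype.piFinset fun _ => Finset.Icc (-(r : ℤ)) r := by
    intro x hx
    rw [mem_l1Ball] at hx
    rw [Fintype.mem_piFinset]
    intro i
    have := (natAbs_le_l1 x i).trans hx
    rw [Finset.mem_Icc]
    omega
  refine (Finset.card_le_card this).trans (le_of_eq ?_)
  rw [Fintype.card_piFinset]
  simp only [Int.card_Icc, Finset.prod_const, Finset.card_univ, Fintype.card_fin]
  congr 1
  omega

/-- The first point of a geodesic: the `ℓ¹`-length can be lowered in steps of any given size. -/
lemma exists_l1_step {d : ℕ} (a : ℕ) (w : Site d) :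
    ∃ u : Site d, l1 u ≤ a ∧ l1 (w - u) ≤ l1 w - a := by
  induction a with
  | zero => exact ⟨0, by simp⟩
  | succ a ih =>
    obtain ⟨u, hu, hw⟩ := ih
    by_cases h : w - u = 0
    · exact ⟨u, by omega, by simp [h]⟩
    obtain ⟨i, hi⟩ := Function.ne_iff.mp h
    have hi' : (w - u) i ≠ 0 := by simpa using hi
    set e : Site d := Pi.single i ((w - u) i).sign with he
    refine ⟨u + e, ?_, ?_⟩
    · refine (l1_add_le _ _).trans ?_
      rw [l1_single, Int.natAbs_sign_of_ne_zero hi']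
      omega
    · have key : l1 (w - (u + e)) + 1 = l1 (w - u) := by
        unfold l1
        rw [← Finset.add_sum_erase _ (fun j => ((w - (u + e)) j).natAbs) (Finset.mem_univ i),
          ← Finset.add_sum_erase _ (fun j => ((w - u) j).natAbs) (Finset.mem_univ i)]
        have : ∑ j ∈ Finset.univ.erase i, ((w - (u + e)) j).natAbs
            = ∑ j ∈ Finset.univ.erase i, ((w - u) j).natAbs := by
          refine Finset.sum_congr rfl fun j hj => ?_
          have : e j = 0 := Pi.single_eq_of_ne (Finset.ne_of_mem_erase hj) _
          simp [this]
        rw [this]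
        have h2 : ((w - (u + e)) i).natAbs + 1 = ((w - u) i).natAbs := by
          have e' : (w - (u + e)) i = (w - u) i - ((w - u) i).sign := by
            simp [he]; ring
          rw [e']
          generalize (w - u) i = t at hi'
          rcases lt_trichotomy t 0 with h | h | h
          · rw [Int.sign_eq_neg_one_of_neg h]; omega
          · exact absurd h hi'
          · rw [Int.sign_eq_one_of_pos h]; omega
        omega
      omega

/-! ### Parity and fixed-point-free involutions -/

lemma even_card_of_involution {α : Type*} (s : Finset α) (g : α → α) (hg : ∀ a ∈ s, g a ∈ s)
    (hne : ∀ a ∈ s, g a ≠ a) (hinv : ∀ a ∈ s, g (g a) = a) : Even s.card := by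
  have : ∑ _a ∈ s, (1 : ZMod 2) = 0 :=
    Finset.sum_involution (fun a _ => g a) (fun _ _ => by decide) (fun a ha _ => hne a ha) hg hinv
  simpa [ZMod.natCast_eq_zero_iff_even] using this

/-! ### Deterministic local algorithms -/

/-- On a torus with an odd number of vertices, there is no perfect matching at all. -/
theorem not_inLOCAL_diagMatching (d : ℕ) (hd : 1 ≤ d) (K : ℝ) (c : ℕ) (hK : 1 ≤ K) (hc : 1 ≤ c)
    (g : ℕ → ℕ) : ¬ InLOCAL (diagMatching d) K c g := by
  rintro ⟨f, -, A, hA⟩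
  obtain ⟨n₀, hn₀⟩ := eventually_atTop.mp hA
  set s := 2 * n₀ + 3 with hs
  have hsn : n₀ ≤ s ^ d := (by omega : n₀ ≤ s).trans (Nat.le_self_pow (by omega) s)
  have : NeZero s := ⟨by omega⟩
  have hcard : Fintype.card (Torus fun _ : Fin d => s) = s ^ d := by
    simp [ZMod.card]
  have hroot : ((s ^ d : ℕ) : ℝ) ^ (1 / (d : ℝ)) = s := by
    rw [Nat.cast_pow, one_div, Real.pow_rpow_inv_natCast (by positivity) (by omega)]
  have e : Torus (fun _ : Fin d => s) ≃ Fin (s ^ d) := Fintype.equivFinOfCardEq hcard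
  have hsol := hn₀ (s ^ d) hsn (fun _ => s) (fun _ => by omega) (by simp)
    (fun i => by
      rw [hroot]
      exact ⟨div_le_self (by positivity) hK, le_mul_of_one_le_left (by positivity) hK⟩)
    (fun v => (e v).val + 1) (fun u v h => e.injective (Fin.ext (by simpa using h)))
    (fun v => ⟨by omega, (Nat.succ_le_of_lt (e v).2).trans (Nat.le_self_pow (by omega) _)⟩)
  set col : Torus (fun _ : Fin d => s) → Direction d d := fun v =>
    A (s ^ d) (nbhd (torusProj fun _ => s) (fun v => (e v).val + 1) v (f (s ^ d))) with hcol
  set π := torusProj (fun _ : Fin d => s) with hπ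
  have hadd : ∀ a b, π (a + b) = π a + π b := by
    intro a b; ext i; simp [hπ, torusProj]
  have hzero : π 0 = 0 := by ext i; simp [hπ, torusProj]
  have hinv : ∀ v, (col (v + π (col v).1)).1 = -(col v).1 := by
    intro v
    have h : (col (v + π (col (v + π 0)).1)).1 = -(col (v + π 0)).1 := hsol v
    rwa [hzero, add_zero] at h
  have hev := even_card_of_involution (Finset.univ : Finset (Torus fun _ : Fin d => s))
    (fun v => v + π (col v).1) (fun _ _ => Finset.mem_univ _) ?_ ?_
  · rw [Finset.card_univ, hcard, Nat.even_pow] at hev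
    have := hev.1
    rw [hs] at this
    exact absurd this (by rw [Nat.not_even_iff_odd]; exact ⟨n₀ + 1, by ring⟩)
  · intro v _ h
    have h0 : π (col v).1 = 0 := by simpa using h
    apply (col v).2.1.1
    ext i
    have h1 : (((col v).1 i : ℤ) : ZMod s) = 0 := congrFun h0 i
    rw [ZMod.intCast_zmod_eq_zero_iff_dvd] at h1
    have h2 : ((col v).1 i).natAbs ≤ 2 := (natAbs_le_l1 _ i).trans (col v).l1_le
    have h3 := Int.eq_zero_of_abs_lt_dvd h1 (by rw [Int.abs_eq_natAbs]; omega)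
    simp [h3]
  · intro v _
    rw [hinv v, add_assoc, ← hadd, add_neg_cancel, hzero, add_zero]

/-! ### Independent labels and uniform local algorithms -/

instance (d : ℕ) : IsProbabilityMeasure (iid d) := by unfold iid; infer_instance

/-- Reading independent labels at distinct places gives independent labels. -/
lemma measurePreserving_reindex {d l : ℕ} (σ : Site l → Site d) (hσ : Function.Injective σ) :
    MeasurePreserving (fun (x : RandomLabels d) u => x (σ u)) (iid d) (iid l) := by
  classical
  have hm : Measurable (fun (x : RandomLabels d) (u : Site l) => x (σ u)) :=
    measurable_pi_lambda _ fun u => measurable_pi_apply _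
  refine ⟨hm, ?_⟩
  unfold iid
  refine Measure.eq_infinitePi _ fun s t ht => ?_
  rw [Measure.map_apply hm (MeasurableSet.pi s.countable_toSet fun i _ => ht i)]
  have h : (fun (x : RandomLabels d) (u : Site l) => x (σ u)) ⁻¹' (Set.pi s t)
      = Set.pi (s.image σ : Finset (Site d)) fun w => t (Function.invFun σ w) := by
    ext x
    simp [Set.mem_pi, Function.leftInverse_invFun hσ _]
  rw [h, Measure.infinitePi_pi _ (fun i _ => ht _), Finset.prod_image fun a _ b _ h => hσ h]
  exact Finset.prod_congr rfl fun u _ => by rw [Function.leftInverse_invFun hσ u]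

/-- For possibly non-measurable events, reindexing does not increase the outer measure. -/
lemma iid_reindex_le {d l : ℕ} (σ : Site l → Site d) (hσ : Function.Injective σ)
    (s : Set (RandomLabels l)) : iid d {x | (fun u => x (σ u)) ∈ s} ≤ iid l s := by
  have h := measurePreserving_reindex σ hσ
  exact (Measure.le_map_apply h.measurable.aemeasurable s).trans_eq (by rw [h.map_eq])

namespace UniformAlgorithm

variable {d : ℕ} {Out : Type} (A : UniformAlgorithm d Out)

lemma codingRadius_le_iff {x : RandomLabels d} {v : Site d} {S : ℕ} :
    A.codingRadius x v ≤ S ↔ ∃ r ≤ S, A.rule r (nbhd id x v r) ≠ none := by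
  unfold codingRadius
  constructor
  · intro h
    by_contra! hn
    have : ((S + 1 : ℕ) : ℕ∞) ≤ (S : ℕ∞) := by
      refine le_trans (le_iInf₂ fun r hr => ?_) h
      exact_mod_cast Nat.succ_le_of_lt (not_le.mp fun hle => hr (hn r hle))
    exact absurd (ENat.natCast_le_natCast.mp this) (by omega)
  · rintro ⟨r, hr, h⟩
    exact (iInf₂_le r h).trans (by exact_mod_cast hr)

lemma outputs_iff {x : RandomLabels d} {v : Site d} {o : Out} :
    A.Outputs x v o ↔ ∃ r, A.rule r (nbhd id x v r) = some o ∧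
      ∀ r' < r, A.rule r' (nbhd id x v r') = none := by
  unfold Outputs
  refine exists_congr fun r => ?_
  constructor
  · rintro ⟨h, ho⟩
    refine ⟨ho, fun r' hr' => ?_⟩
    by_contra hn
    have := (A.codingRadius_le_iff (S := r')).mpr ⟨r', le_rfl, hn⟩
    rw [h] at this
    exact absurd (ENat.natCast_le_natCast.mp this) (by omega)
  · rintro ⟨ho, h⟩
    refine ⟨le_antisymm ((A.codingRadius_le_iff).mpr ⟨r, le_rfl, by simp [ho]⟩) ?_, ho⟩
    refine le_iInf₂ fun r' hr' => ?_
    exact_mod_cast not_lt.mp fun hlt => hr' (h r' hlt)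

variable {A}

lemma Outputs.unique {x : RandomLabels d} {v : Site d} {o o' : Out} (h : A.Outputs x v o)
    (h' : A.Outputs x v o') : o = o' := by
  obtain ⟨r, hr, hro⟩ := h
  obtain ⟨r', hr', hro'⟩ := h'
  obtain rfl : r = r' := by exact_mod_cast hr.symm.trans hr'
  exact Option.some.inj (hro.symm.trans hro')

/-- The run of the algorithm up to radius `S` depends only on the labels within distance `S`. -/
lemma outputs_congr {x x' : RandomLabels d} {v v' : Site d} {S : ℕ}
    (hx : ∀ y, l1 y ≤ S → x (v + y) = x' (v' + y)) (hS : A.codingRadius x v ≤ S) :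
    A.codingRadius x' v' ≤ S ∧ ∀ o, A.Outputs x v o → A.Outputs x' v' o := by
  have hn : ∀ r ≤ S, nbhd id x v r = nbhd id x' v' r := fun r hr =>
    funext fun y => hx _ (y.2.trans hr)
  rw [codingRadius_le_iff] at hS ⊢
  obtain ⟨r, hr, h⟩ := hS
  refine ⟨⟨r, hr, by rwa [← hn r hr]⟩, fun o ho => ?_⟩
  rw [outputs_iff] at ho ⊢
  obtain ⟨r₁, h1, h2⟩ := ho
  have hr₁ : r₁ ≤ S := le_trans (not_lt.mp fun hlt => h (h2 r hlt)) hr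
  exact ⟨r₁, by rwa [← hn r₁ hr₁], fun r' hr' => by rw [← hn r' (by omega)]; exact h2 r' hr'⟩

lemma exists_outputs {x : RandomLabels d} {v : Site d} {S : ℕ} (hS : A.codingRadius x v ≤ S) :
    ∃ o, A.Outputs x v o := by
  obtain ⟨r, hr⟩ := ENat.ne_top_iff_exists.mp (ne_top_of_le_ne_top (ENat.natCast_ne_top S) hS)
  obtain ⟨r', hr', h⟩ := (A.codingRadius_le_iff).mp hr.symm.le
  have hle : r ≤ r' := by
    have := (A.codingRadius_le_iff (S := r')).mpr ⟨r', le_rfl, h⟩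
    rw [← hr] at this
    exact_mod_cast this
  obtain rfl : r' = r := le_antisymm hr' hle
  obtain ⟨o, ho⟩ := Option.ne_none_iff_exists'.mp h
  exact ⟨o, r', hr.symm, ho⟩

lemma nbhd_shift {d : ℕ} {α : Type} (x : Site d → α) (v w : Site d) (r : ℕ) :
    nbhd id (fun u => x (v + u)) w r = nbhd id x (v + w) r := by
  funext y
  simp [nbhd, add_assoc]

lemma codingRadius_shift (x : RandomLabels d) (v w : Site d) :
    A.codingRadius (fun u => x (v + u)) w = A.codingRadius x (v + w) := by
  simp [codingRadius, nbhd_shift]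

lemma outputs_shift (x : RandomLabels d) (v w : Site d) (o : Out) :
    A.Outputs (fun u => x (v + u)) w o ↔ A.Outputs x (v + w) o := by
  simp [outputs_iff, nbhd_shift]

lemma iid_codingRadius_le (v : Site d) (S : ℕ) :
    iid d {x | (S : ℕ∞) < A.codingRadius x v} ≤ iid d {x | (S : ℕ∞) < A.codingRadius x 0} := by
  refine le_trans (measure_mono fun x hx => ?_)
    (iid_reindex_le (v + ·) (add_right_injective v) {x | (S : ℕ∞) < A.codingRadius x 0})
  simpa [codingRadius_shift] using hx

end UniformAlgorithm

/-- The perfect matching problem asks that the outputs of partners are opposite. -/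
lemma subgridMatching_isColoring_iff_neg {d l : ℕ} (c : Site d → Direction d l) :
    (subgridMatching d l).IsColoring id c ↔ ∀ v, (c (v + (c v).1)).1 = -(c v).1 := by
  refine forall_congr' fun v => ?_
  change (c (v + (c (v + 0)).1)).1 = -(c (v + 0)).1 ↔ _
  rw [add_zero]

/-! ### The parity obstruction on cells of a torus -/

/-- The cube of side `N` in the first `l` coordinates with least corner `b`. -/
noncomputable def cube {d : ℕ} (l N : ℕ) (b : Site d) : Finset (Site d) :=
  Fintype.piFinset fun i => if i.val < l then Finset.Ico (b i) (b i + N) else {b i}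

lemma mem_cube {d l N : ℕ} {b v : Site d} :
    v ∈ cube l N b ↔ ∀ i : Fin d, (i.val < l → b i ≤ v i ∧ v i < b i + N) ∧
      (l ≤ i.val → v i = b i) := by
  unfold cube
  rw [Fintype.mem_piFinset]
  refine forall_congr' fun i => ?_
  split_ifs with h
  · simp [h, not_le.mpr h]
  · simp [h, not_lt.mp h]

lemma odd_card_cube {d l N : ℕ} (hN : Odd N) (b : Site d) : Odd (cube l N b).card := by
  unfold cube
  rw [Fintype.card_piFinset]
  refine Finset.prod_induction _ Odd (fun _ _ => Odd.mul) odd_one fun i _ => ?_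
  split_ifs <;> simp [hN]

/-- The vertex `v` has a possible partner on the other side of the boundary of the cube. -/
def NearBoundary {d : ℕ} (l N : ℕ) (b v : Site d) : Prop :=
  ∃ s : Direction d l, ¬ (v ∈ cube l N b ↔ v + s.1 ∈ cube l N b)

/-- Near the boundary of the cube the algorithm stops within radius `S`, its outputs match the
vertices of the cube with partners outside consistently, and their number is odd. -/
def OddBoundary {d l : ℕ} (A : UniformAlgorithm d (Direction d l)) (N S : ℕ)
    (z : RandomLabels d) (b : Site d) : Prop :=
  ∃ c : Site d → Direction d l,
    (∀ v, NearBoundary l N b v → A.codingRadius z v ≤ S ∧ A.Outputs z v (c v)) ∧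
    (∀ v ∈ cube l N b, v + (c v).1 ∉ cube l N b → (c (v + (c v).1)).1 = -(c v).1) ∧
    Odd {v ∈ cube l N b | v + (c v).1 ∉ cube l N b}.card

section
variable {d l : ℕ} {A : UniformAlgorithm d (Direction d l)} {N S : ℕ}

lemma oddBoundary_of_solves (hA : A.Solves (subgridMatching d l)) (hN : Odd N) :
    ∀ᵐ x ∂(iid d), (∀ v, NearBoundary l N 0 v → A.codingRadius x v ≤ S) →
      OddBoundary A N S x 0 := by
  filter_upwards [hA] with x hx hS
  obtain ⟨c, hc, hcol⟩ := hx
  rw [subgridMatching_isColoring_iff_neg] at hcol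
  refine ⟨c, fun v hv => ⟨hS v hv, hc v⟩, fun v _ _ => hcol v, ?_⟩
  have hev : Even {v ∈ cube l N (0 : Site d) | v + (c v).1 ∈ cube l N 0}.card := by
    refine even_card_of_involution _ (fun v => v + (c v).1) ?_ ?_ ?_
    · intro v hv
      rw [Finset.mem_filter] at hv ⊢
      refine ⟨hv.2, ?_⟩
      rw [hcol v, add_neg_cancel_right]
      exact hv.1
    · intro v _ h
      have h0 : (c v).1 = 0 := by simpa using h
      exact (c v).2.1.1 h0.symm
    · intro v _
      rw [hcol v, add_neg_cancel_right]
  have hsum := Finset.card_filter_add_card_filter_not (s := cube l N (0 : Site d))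
    (fun v => v + (c v).1 ∈ cube l N 0)
  have hodd := odd_card_cube (l := l) hN (0 : Site d)
  rw [← hsum] at hodd
  exact (Nat.odd_add'.mp hodd).mpr hev

lemma OddBoundary.transfer {z z' : RandomLabels d} {b : Site d}
    (h : ∀ v, NearBoundary l N 0 v → ∀ y, l1 y ≤ S → z' (v + y) = z (b + v + y))
    (hz : OddBoundary A N S z' 0) : OddBoundary A N S z b := by
  obtain ⟨c, h1, h2, h3⟩ := hz
  have hcube : ∀ v, v ∈ cube l N b ↔ v - b ∈ cube l N 0 := by
    intro v
    simp only [mem_cube, Pi.sub_apply, Pi.zero_apply]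
    refine forall_congr' fun i => and_congr (imp_congr_right fun _ => ?_)
      (imp_congr_right fun _ => ?_) <;> omega
  have hcube' : ∀ v s : Site d, v + s ∈ cube l N b ↔ v - b + s ∈ cube l N 0 := by
    intro v s
    rw [hcube, add_sub_right_comm]
  refine ⟨fun v => c (v - b), ?_, ?_, ?_⟩
  · rintro v ⟨s, hs⟩
    have hv : NearBoundary l N 0 (v - b) := ⟨s, by rwa [← hcube, ← hcube']⟩
    obtain ⟨hR, hO⟩ := h1 _ hv
    have := UniformAlgorithm.outputs_congr (x' := z) (v' := v) (A := A)
      (fun y hy => by rw [h _ hv y hy, add_sub_cancel]) hR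
    exact ⟨this.1, this.2 _ hO⟩
  · intro v hv hs
    beta_reduce
    rw [add_sub_right_comm]
    exact h2 _ ((hcube v).mp hv) fun hh => hs ((hcube' _ _).mpr hh)
  · convert h3 using 1
    refine Finset.card_bij (fun v _ => v - b) ?_ ?_ ?_
    · intro v hv
      rw [Finset.mem_filter] at hv ⊢
      exact ⟨(hcube v).mp hv.1, fun hh => hv.2 ((hcube' _ _).mpr hh)⟩
    · intro v _ w _ hvw
      exact sub_left_injective hvw
    · intro v hv
      rw [Finset.mem_filter] at hv
      refine ⟨v + b, ?_, by simp⟩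
      rw [Finset.mem_filter, hcube, hcube']
      beta_reduce
      rw [add_sub_cancel_right]
      exact hv

/-- The corners of the `3^l` cubes of side `N` that tile the cube of side `3 N`. -/
noncomputable def corners (d l N : ℕ) : Finset (Site d) :=
  Fintype.piFinset fun i => if i.val < l then ({0, (N : ℤ), 2 * (N : ℤ)} : Finset ℤ) else {0}

lemma card_corners (d l N : ℕ) (hN : 0 < N) (hl : l ≤ d) : (corners d l N).card = 3 ^ l := by
  unfold corners
  rw [Fintype.card_piFinset]
  have : ∀ i : Fin d, (if i.val < l then ({0, (N : ℤ), 2 * (N : ℤ)} : Finset ℤ) else {0}).card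
      = if i.val < l then 3 else 1 := by
    intro i
    split_ifs
    · rw [Finset.card_eq_three]
      exact ⟨0, N, 2 * N, by omega, by omega, by omega, rfl⟩
    · simp
  rw [Finset.prod_congr rfl fun i _ => this i, Finset.prod_ite]
  simp [Fin.card_filter_val_lt, hl]

lemma mem_corners {N : ℕ} {b : Site d} : b ∈ corners d l N ↔
    ∀ i : Fin d, (i.val < l → b i = 0 ∨ b i = N ∨ b i = 2 * N) ∧ (l ≤ i.val → b i = 0) := by
  unfold corners
  rw [Fintype.mem_piFinset]
  refine forall_congr' fun i => ?_
  split_ifs with h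
  · simp [h, not_le.mpr h]
  · simp [h, not_lt.mp h]

/-- The cubes that tile a torus of side `3 N` cannot all have an odd number of vertices with
partners outside: these vertices are matched with each other, and `3 ^ l` is odd. -/
lemma not_forall_oddBoundary (hl : l ≤ d) (hN : 0 < N) {z : RandomLabels d}
    (hz : ∀ v v' : Site d, (∀ i, v i % (3 * N : ℤ) = v' i % (3 * N : ℤ)) → z v = z v') :
    ¬ ∀ b ∈ corners d l N, OddBoundary A N S z b := by
  intro h
  have : Nonempty (Direction d l) := by
    obtain ⟨b, hb⟩ := Finset.card_pos.mp ((card_corners d l N hN hl).symm ▸ pow_pos (by omega) l :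
      0 < (corners d l N).card)
    obtain ⟨c, -⟩ := h b hb
    exact ⟨c b⟩
  choose! c h1 h2 h3 using h
  set X : Finset (Σ _ : Site d, Site d) := (corners d l N).sigma fun b =>
    {v ∈ cube l N b | v + (c b v).1 ∉ cube l N b} with hX
  have hmem : ∀ p, p ∈ X ↔ p.1 ∈ corners d l N ∧ p.2 ∈ cube l N p.1 ∧
      p.2 + (c p.1 p.2).1 ∉ cube l N p.1 := by
    intro p
    simp [hX, Finset.mem_sigma]
  have hodd : Odd X.card := by
    rw [hX, Finset.card_sigma, Finset.odd_sum_iff_odd_card_odd, Finset.filter_true_of_mem h3,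
      card_corners d l N hN hl]
    exact Odd.pow (by decide)
  set red : Site d → Site d := fun u i => u i % (3 * N : ℤ) with hred
  set low : Site d → Site d := fun u i => N * (u i / (N : ℤ)) with hlow
  have hNz : (0 : ℤ) < N := by exact_mod_cast hN
  -- a vertex of a cube is reduced, and it determines the corner of the cube
  have hfix : ∀ b ∈ corners d l N, ∀ v ∈ cube l N b, red v = v ∧ low v = b := by
    intro b hb v hv
    rw [mem_corners] at hb
    rw [mem_cube] at hv
    have key : ∀ i, 0 ≤ v i ∧ v i < 3 * N ∧ N * (v i / (N : ℤ)) = b i := by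
      intro i
      rcases lt_or_ge i.val l with hi | hi
      · have h1 := (hb i).1 hi
        have h2 := (hv i).1 hi
        refine ⟨by omega, by omega, ?_⟩
        have hq : v i / (N : ℤ) = b i / N := by
          rcases h1 with h1 | h1 | h1
          · rw [h1] at h2 ⊢
            rw [Int.zero_ediv, Int.ediv_eq_zero_of_lt h2.1 (by omega)]
          · rw [h1, Int.ediv_self (by omega)]
            rw [h1] at h2
            exact (Int.ediv_eq_iff_of_pos hNz).mpr ⟨by omega, by omega⟩
          · rw [h1, Int.mul_ediv_cancel _ (by omega)]
            rw [h1] at h2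
            exact (Int.ediv_eq_iff_of_pos hNz).mpr ⟨by omega, by omega⟩
        rw [hq]
        rcases h1 with h1 | h1 | h1
        · simp [h1]
        · rw [h1, Int.ediv_self (by omega)]; ring
        · rw [h1, Int.mul_ediv_cancel _ (by omega)]; ring
      · have h1 := (hb i).2 hi
        have h2 := (hv i).2 hi
        rw [h2, h1]
        simp [hN]
    exact ⟨funext fun i => Int.emod_eq_of_lt (key i).1 (key i).2.1, funext fun i => (key i).2.2⟩
  have hredred : ∀ u w : Site d, red (red u + w) = red (u + w) := by
    intro u w
    ext i
    simp [hred]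
  -- the partner on the torus
  set g : (Σ _ : Site d, Site d) → (Σ _ : Site d, Site d) := fun p =>
    ⟨low (red (p.2 + (c p.1 p.2).1)), red (p.2 + (c p.1 p.2).1)⟩ with hg
  have main : ∀ p ∈ X, g p ∈ X ∧ (c (g p).1 (g p).2).1 = -(c p.1 p.2).1 := by
    rintro ⟨b, v⟩ hp
    obtain ⟨hb, hv, hu⟩ := (hmem _).mp hp
    simp only at hb hv hu
    set u := v + (c b v).1 with hu_def
    have hcu : (c b u).1 = -(c b v).1 := h2 b hb v hv hu
    have hu0 : ∀ i : Fin d, l ≤ i.val → u i = 0 := by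
      intro i hi
      have e1 := ((mem_cube.mp hv) i).2 hi
      have e2 := ((mem_corners.mp hb) i).2 hi
      have e3 : (c b v).1 i = 0 := by simpa using ((c b v).2.2 i hi).symm
      simp [hu_def, e1, e2, e3]
    have hb' : low (red u) ∈ corners d l N := by
      rw [mem_corners]
      intro i
      have r1 : 0 ≤ u i % (3 * N : ℤ) := Int.emod_nonneg _ (by omega)
      have r2 : u i % (3 * N : ℤ) < 3 * N := Int.emod_lt_of_pos _ (by omega)
      refine ⟨fun _ => ?_, fun hi => by simp [hlow, hred, hu0 i hi]⟩
      change N * (u i % (3 * N : ℤ) / N) = 0 ∨ N * (u i % (3 * N : ℤ) / N) = N ∨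
        N * (u i % (3 * N : ℤ) / N) = 2 * N
      have q1 : 0 ≤ u i % (3 * N : ℤ) / N := Int.ediv_nonneg r1 hNz.le
      have q2 : u i % (3 * N : ℤ) / N < 3 := Int.ediv_lt_of_lt_mul hNz r2
      generalize u i % (3 * N : ℤ) / N = q at q1 q2
      interval_cases q
      · simp
      · simp
      · right; right; ring
    have hu' : red u ∈ cube l N (low (red u)) := by
      rw [mem_cube]
      intro i
      refine ⟨fun _ => ⟨Int.mul_ediv_self_le (by omega), ?_⟩,
        fun hi => by simp [hlow, hred, hu0 i hi]⟩
      have := Int.lt_mul_ediv_self_add (x := red u i) hNz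
      simpa [hlow] using this
    have hback : red (red u + (c b u).1) = v := by
      rw [hredred, hcu, hu_def, add_neg_cancel_right]
      exact (hfix b hb v hv).1
    have hout : red u + (c b u).1 ∉ cube l N (low (red u)) := by
      intro hin
      obtain ⟨f1, f2⟩ := hfix _ hb' _ hin
      rw [hback] at f1
      rw [← f1, (hfix b hb v hv).2] at f2
      have : red u = u := by
        have e : red u + (c b u).1 = v := f1.symm
        rw [hcu] at e
        exact add_neg_eq_iff_eq_add.mp e
      rw [← f2, this] at hu'
      exact hu hu'
    have hc : c (low (red u)) (red u) = c b u := by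
      have n1 : NearBoundary l N b u := ⟨c b u, by
        rw [hcu, hu_def, add_neg_cancel_right]
        exact fun hh => hu (hh.mpr hv)⟩
      have n2 : NearBoundary l N (low (red u)) (red u) := ⟨c b u, fun hh => hout (hh.mp hu')⟩
      obtain ⟨o1, o2⟩ := h1 b hb u n1
      refine (h1 _ hb' _ n2).2.unique ((UniformAlgorithm.outputs_congr
        (fun y _ => hz _ _ fun i => ?_) o1).2 _ o2)
      simp [hred]
    refine ⟨(hmem _).mpr ⟨hb', hu', ?_⟩, ?_⟩
    · change red u + (c (low (red u)) (red u)).1 ∉ cube l N (low (red u))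
      rw [hc]
      exact hout
    · change (c (low (red u)) (red u)).1 = _
      rw [hc, hcu]
  refine absurd (even_card_of_involution X g (fun p hp => (main p hp).1) ?_ ?_)
    (Nat.not_even_iff_odd.mpr hodd)
  · intro p hp he
    have := (main p hp).2
    rw [he] at this
    apply (c p.1 p.2).2.1.1
    ext i
    have hi : (c p.1 p.2).1 i = -(c p.1 p.2).1 i := congrFun this i
    simp only [Pi.zero_apply]
    omega
  · rintro ⟨b, v⟩ hp
    obtain ⟨hb, hv, hu⟩ := (hmem _).mp hp
    have hm := (main _ hp).2
    have : red ((g ⟨b, v⟩).2 + (c (g ⟨b, v⟩).1 (g ⟨b, v⟩).2).1) = v := by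
      rw [hm]
      change red (red (v + (c b v).1) + -(c b v).1) = v
      rw [hredred, add_neg_cancel_right]
      exact (hfix b hb v hv).1
    change (⟨low (red ((g ⟨b, v⟩).2 + (c (g ⟨b, v⟩).1 (g ⟨b, v⟩).2).1)),
      red ((g ⟨b, v⟩).2 + (c (g ⟨b, v⟩).1 (g ⟨b, v⟩).2).1)⟩ : Σ _ : Site d, Site d) = ⟨b, v⟩
    rw [this, (hfix b hb v hv).2]

/-- The vertices near the boundary of a cube of side `N` lie within distance `2` of its faces. -/
lemma exists_nearBoundary_subset (d l N : ℕ) (hl : l ≤ d) :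
    ∃ F : Finset (Site d), (∀ v, NearBoundary l N 0 v → v ∈ F) ∧
      (∀ v ∈ F, ∀ i, -2 ≤ v i ∧ v i < N + 2) ∧ F.card ≤ 8 * d * (N + 4) ^ (l - 1) := by
  classical
  set face : Fin d → Finset (Site d) := fun i₀ => Fintype.piFinset fun i =>
    if i = i₀ then Finset.Ico (-2 : ℤ) 2 ∪ Finset.Ico (N - 2 : ℤ) (N + 2)
    else if i.val < l then Finset.Ico (-2 : ℤ) (N + 2) else {0} with hface
  refine ⟨(Finset.univ.filter fun i : Fin d => i.val < l).biUnion face, ?_, ?_, ?_⟩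
  · rintro v ⟨s, hs⟩
    have hs2 : ∀ i, -2 ≤ s.1 i ∧ s.1 i ≤ 2 := fun i => by
      have := (natAbs_le_l1 s.1 i).trans s.l1_le
      omega
    have hs0 : ∀ i : Fin d, l ≤ i.val → s.1 i = 0 := fun i hi => (s.2.2 i hi).symm
    have hv : (∀ i : Fin d, i.val < l → -2 ≤ v i ∧ v i < N + 2) ∧
        ∀ i : Fin d, l ≤ i.val → v i = 0 := by
      have hor : v ∈ cube l N 0 ∨ v + s.1 ∈ cube l N 0 := by tauto
      rcases hor with h | h <;> rw [mem_cube] at h <;> refine ⟨fun i hi => ?_, fun i hi => ?_⟩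
      · have := (h i).1 hi
        simp only [Pi.zero_apply] at this
        omega
      · simpa using (h i).2 hi
      · have := (h i).1 hi
        have := hs2 i
        simp only [Pi.zero_apply, Pi.add_apply] at *
        omega
      · simpa [hs0 i hi] using (h i).2 hi
    have hex : ∃ i : Fin d, i.val < l ∧
        ¬ ((0 ≤ v i ∧ v i < N) ↔ (0 ≤ v i + s.1 i ∧ v i + s.1 i < N)) := by
      by_contra! hn
      apply hs
      rw [mem_cube, mem_cube]
      refine forall_congr' fun i => and_congr (forall_congr' fun hi => ?_)
        (forall_congr' fun hi => ?_)
      · simpa using hn i hi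
      · simp [hs0 i hi]
    obtain ⟨i₀, hi₀, hne⟩ := hex
    rw [Finset.mem_biUnion]
    refine ⟨i₀, by simp [hi₀], ?_⟩
    rw [hface, Fintype.mem_piFinset]
    intro i
    split_ifs with h1 h2
    · subst h1
      have := hs2 i
      rw [Finset.mem_union, Finset.mem_Ico, Finset.mem_Ico]
      omega
    · rw [Finset.mem_Ico]
      exact hv.1 i h2
    · rw [Finset.mem_singleton]
      exact hv.2 i (not_lt.mp h2)
  · intro v hv i
    rw [Finset.mem_biUnion] at hv
    obtain ⟨i₀, -, h⟩ := hv
    have := (Fintype.mem_piFinset.mp h) i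
    split_ifs at this <;> simp only [Finset.mem_union, Finset.mem_Ico, Finset.mem_singleton] at this
      <;> omega
  · refine Finset.card_biUnion_le.trans ?_
    have hle : ∀ i₀ ∈ Finset.univ.filter (fun i : Fin d => i.val < l),
        (face i₀).card ≤ 8 * (N + 4) ^ (l - 1) := by
      intro i₀ hi₀
      rw [hface, Fintype.card_piFinset, ← Finset.mul_prod_erase _ _ (Finset.mem_univ i₀)]
      refine Nat.mul_le_mul ?_ ?_
      · rw [if_pos rfl]
        exact (Finset.card_union_le _ _).trans (by simp only [Int.card_Ico]; omega)
      · have : ∀ i ∈ Finset.univ.erase i₀, (if i = i₀ then Finset.Ico (-2 : ℤ) 2 ∪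
            Finset.Ico (N - 2 : ℤ) (N + 2) else if i.val < l then Finset.Ico (-2 : ℤ) (N + 2)
            else {0}).card = if i.val < l then N + 4 else 1 := by
          intro i hi
          rw [if_neg (Finset.ne_of_mem_erase hi)]
          split_ifs
          · rw [Int.card_Ico]; omega
          · simp
        rw [Finset.prod_congr rfl this, Finset.prod_ite, Finset.prod_const, Finset.prod_const_one,
          mul_one, Finset.filter_erase, Finset.card_erase_of_mem hi₀, Fin.card_filter_val_lt,
          min_eq_right hl]
    refine (Finset.sum_le_card_nsmul _ _ _ hle).trans ?_
    rw [Fin.card_filter_val_lt, min_eq_right hl, smul_eq_mul]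
    calc l * (8 * (N + 4) ^ (l - 1)) ≤ d * (8 * (N + 4) ^ (l - 1)) := Nat.mul_le_mul_right _ hl
      _ = _ := by ring

/-- The lower bound for the tail of the coding radius `R`: up to constants, `P(R > S)` is at least
the inverse of the number of vertices close to the boundary of a cube of odd side `N ≥ 4 S`. Indeed,
if all these vertices of a cube stop within radius `S`, then the boundary is odd. This event is seen
within distance `S + 2` of the cube, so it has the same probability for the cubes of the torus of
side `3 N`, where it fails for at least one cube. -/
lemma one_le_card_mul_iid (hl : l ≤ d) (hA : A.Solves (subgridMatching d l)) (hN : Odd N)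
    (hN3 : 3 < N) (hS : 4 * S ≤ N) :
    1 ≤ ((3 ^ l * (8 * d * (N + 4) ^ (l - 1)) : ℕ) : ℝ≥0∞) *
      iid d {x | (S : ℕ∞) < A.codingRadius x 0} := by
  obtain ⟨F, hF, hFbox, hFcard⟩ := exists_nearBoundary_subset d l N hl
  set q := iid d {x | (S : ℕ∞) < A.codingRadius x 0} with hq
  have hfail : iid d {x | ¬ OddBoundary A N S x 0} ≤ F.card * q := by
    have hsub : iid d {x | ¬ OddBoundary A N S x 0} ≤
        iid d (⋃ v ∈ F, {x | (S : ℕ∞) < A.codingRadius x v}) := by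
      refine measure_mono_ae ?_
      filter_upwards [oddBoundary_of_solves (S := S) hA hN] with x hx hbad
      by_contra hn
      refine hbad (hx fun v hv => ?_)
      by_contra hlt
      exact hn (Set.mem_biUnion (hF v hv) (not_le.mp hlt))
    refine hsub.trans ((measure_biUnion_finset_le _ _).trans ?_)
    refine (Finset.sum_le_card_nsmul _ _ _ fun v _ =>
      UniformAlgorithm.iid_codingRadius_le v S).trans ?_
    rw [nsmul_eq_mul]
  set z : RandomLabels d → RandomLabels d := fun x v => x fun i => v i % (3 * N : ℤ) with hz
  have hbox : ∀ b : Site d, iid d {x | ¬ OddBoundary A N S (z x) b} ≤ F.card * q := by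
    intro b
    -- `θ` embeds the sites so that a window around the cube at `b` is wrapped around the torus
    set θ : Site d → Site d := fun v i =>
      if -(S + 2 : ℤ) ≤ v i ∧ v i < 3 * N - (S + 2) then (b i + v i) % (3 * N : ℤ)
      else v i + (S + 2) with hθ
    have hinj : Function.Injective θ := by
      intro v w hvw
      ext i
      have h := congrFun hvw i
      simp only [hθ] at h
      have m1 := Int.emod_nonneg (b i + v i) (by omega : (3 * N : ℤ) ≠ 0)
      have m2 := Int.emod_lt_of_pos (b i + v i) (by omega : (0 : ℤ) < 3 * N)
      have m3 := Int.emod_nonneg (b i + w i) (by omega : (3 * N : ℤ) ≠ 0)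
      have m4 := Int.emod_lt_of_pos (b i + w i) (by omega : (0 : ℤ) < 3 * N)
      split_ifs at h with c1 c2 c2
      · have hd := Int.emod_emod_of_dvd (b i + v i) (dvd_refl (3 * N : ℤ))
        have h' : (3 * N : ℤ) ∣ (b i + v i) - (b i + w i) :=
          Int.ModEq.dvd (Int.ModEq.symm h)
        rw [add_sub_add_left_eq_sub] at h'
        have := Int.eq_zero_of_abs_lt_dvd h' (by rw [abs_lt]; omega)
        omega
      · omega
      · omega
      · omega
    refine le_trans (measure_mono fun x hx => ?_)
      ((iid_reindex_le θ hinj {x | ¬ OddBoundary A N S x 0}).trans hfail)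
    refine fun hgood => hx (hgood.transfer fun v hv y hy => ?_)
    simp only [hz]
    congr 1
    ext i
    have hvi := hFbox v (hF v hv) i
    have hyi := (natAbs_le_l1 y i).trans hy
    simp only [hθ, Pi.add_apply]
    rw [if_pos (by omega)]
    congr 1
    ring
  have hex : iid d (⋃ b ∈ corners d l N, {x | ¬ OddBoundary A N S (z x) b}) = 1 := by
    have : (⋃ b ∈ corners d l N, {x | ¬ OddBoundary A N S (z x) b}) = Set.univ := by
      refine Set.eq_univ_of_forall fun x => ?_
      have := not_forall_oddBoundary (A := A) (S := S) (z := z x) hl (by omega : 0 < N)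
        fun v v' h => by simp only [hz]; congr 1; ext i; rw [h i]
      push Not at this
      obtain ⟨b, hb, h⟩ := this
      exact Set.mem_biUnion hb h
    rw [this, measure_univ]
  rw [← hex]
  refine (measure_biUnion_finset_le _ _).trans
    ((Finset.sum_le_card_nsmul _ _ _ fun b _ => hbox b).trans ?_)
  rw [card_corners d l N (by omega) hl, nsmul_eq_mul, ← mul_assoc]
  gcongr
  rw [← Nat.cast_mul]
  exact_mod_cast Nat.mul_le_mul_left _ hFcard

end

/-- The lower bound for uniform local algorithms. -/
theorem not_inULOCALLittleO_subgridMatching (d j : ℕ) (hj : 1 ≤ j) (hjd : j + 1 ≤ d) :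
    ¬ InULOCALLittleO (subgridMatching d (j + 1)) (fun ε => (1 / ε) ^ (1 / (j : ℝ))) := by
  rintro ⟨s, hs, A, hA, hcomp⟩
  set c : ℕ := 2 * (3 ^ (j + 1) * (8 * d * 5 ^ j)) with hc
  have hc0 : 0 < c := by have : 0 < d := by omega
                         positivity
  have hj0 : (j : ℝ) ≠ 0 := by positivity
  have hcr : (0 : ℝ) < c := by exact_mod_cast hc0
  set K : ℝ := (c : ℝ) ^ (1 / (j : ℝ)) with hK
  have hK0 : 0 < K := Real.rpow_pos_of_pos hcr _
  have hb := hs.def (c := 1 / (4 * K)) (by positivity)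
  -- the failure probability for which the algorithm sees less than a quarter of a cube of side `N`
  have htend : Tendsto (fun N : ℕ => 1 / ((c : ℝ) * (N : ℝ) ^ j)) atTop (𝓝[>] 0) := by
    rw [tendsto_nhdsWithin_iff]
    refine ⟨?_, ?_⟩
    · have h1 : Tendsto (fun N : ℕ => (c : ℝ) * (N : ℝ) ^ j) atTop atTop :=
        ((tendsto_pow_atTop (by omega)).comp tendsto_natCast_atTop_atTop).const_mul_atTop hcr
      simp only [one_div]
      exact h1.inv_tendsto_atTop
    · filter_upwards [eventually_gt_atTop 0] with N hN
      have : (0 : ℝ) < N := by exact_mod_cast hN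
      simp only [Set.mem_Ioi]
      positivity
  obtain ⟨N₀, hN₀⟩ := eventually_atTop.mp (htend.eventually (hb.and hcomp))
  set N := 2 * N₀ + 5 with hN
  obtain ⟨h1, h2⟩ := hN₀ N (by omega)
  have hNr : (0 : ℝ) < N := by positivity
  have hsN : s (1 / ((c : ℝ) * (N : ℝ) ^ j)) ≤ N / 4 := by
    refine (le_abs_self _).trans (h1.trans_eq ?_)
    rw [one_div_one_div, Real.mul_rpow hcr.le (by positivity), one_div (j : ℝ),
      Real.pow_rpow_inv_natCast hNr.le (by omega), ← one_div (j : ℝ), ← hK, Real.norm_eq_abs,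
      abs_of_pos (by positivity)]
    field_simp
  have key := one_le_card_mul_iid (A := A) (S := N / 4) hjd hA
    (N := N) ⟨N₀ + 2, by omega⟩ (by omega) (by omega)
  have hq : iid d {x | ((N / 4 : ℕ) : ℕ∞) < A.codingRadius x 0} ≤
      ENNReal.ofReal (1 / ((c : ℝ) * (N : ℝ) ^ j)) := by
    refine le_trans (measure_mono fun x hx => ?_) h2
    have hx' : ((N / 4 + 1 : ℕ) : ℕ∞) ≤ A.codingRadius x 0 := by
      have : ((N / 4 : ℕ) : ℕ∞) < A.codingRadius x 0 := hx
      exact_mod_cast Order.add_one_le_of_lt this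
    refine lt_of_lt_of_le ?_ (ENat.toENNReal_le.mpr hx')
    rw [ENat.toENNReal_coe, ENNReal.ofReal_lt_natCast (by omega)]
    refine hsN.trans_lt ?_
    have : N < 4 * (N / 4 + 1) := by omega
    have h4 : (N : ℝ) < 4 * ((N / 4 + 1 : ℕ) : ℝ) := by exact_mod_cast this
    linarith
  have hcount : 3 ^ (j + 1) * (8 * d * (N + 4) ^ (j + 1 - 1)) * 2 ≤ c * N ^ j := by
    have : (N + 4) ^ j ≤ 5 ^ j * N ^ j := by
      rw [← mul_pow]
      exact Nat.pow_le_pow_left (by omega) _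
    rw [Nat.add_sub_cancel, hc]
    calc 3 ^ (j + 1) * (8 * d * (N + 4) ^ j) * 2
        ≤ 3 ^ (j + 1) * (8 * d * (5 ^ j * N ^ j)) * 2 := by gcongr
      _ = _ := by ring
  have hlast : ((3 ^ (j + 1) * (8 * d * (N + 4) ^ (j + 1 - 1)) : ℕ) : ℝ≥0∞) *
      ENNReal.ofReal (1 / ((c : ℝ) * (N : ℝ) ^ j)) ≤ ENNReal.ofReal (1 / 2) := by
    rw [← ENNReal.ofReal_natCast, ← ENNReal.ofReal_mul (by positivity)]
    refine ENNReal.ofReal_le_ofReal ?_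
    rw [mul_one_div, div_le_div_iff₀ (by positivity) (by norm_num), one_mul]
    exact_mod_cast hcount
  have hfin := (key.trans (mul_le_mul_right hq _)).trans hlast
  rw [ENNReal.one_le_ofReal] at hfin
  norm_num at hfin

/-! ### Hubs and the paths between them -/

/-- The length scale `2 ^ k²` of level `k`. -/
def scale (k : ℕ) : ℕ := 2 ^ (k ^ 2)

/-- Every site has a hub of level `k` within this distance. -/
def coverRadius : ℕ → ℕ
  | 0 => 0
  | k + 1 => scale (k + 1)

/-- Hubs of level `k` within this distance are joined by a path of level `k`. -/
def joinRadius (k : ℕ) : ℕ := scale k + 2 * coverRadius k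

/-- The number of paths of level `k` that make up a path of level `k + 1`. -/
def numSteps (k : ℕ) : ℕ := 3 * 2 ^ (2 * k + 1)

/-- A bound for the length of the paths of level `k`. -/
def pathLen (k : ℕ) : ℕ := 2 * 3 ^ k * scale k

lemma scale_pos (k : ℕ) : 0 < scale k := by unfold scale; positivity

lemma scale_succ (k : ℕ) : scale (k + 1) = 2 ^ (2 * k + 1) * scale k := by
  unfold scale; ring

lemma two_mul_scale_le (k : ℕ) : 2 * scale k ≤ scale (k + 1) := by
  rw [scale_succ]
  exact Nat.mul_le_mul_right _ (Nat.le_self_pow (by omega) 2)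

lemma coverRadius_le (k : ℕ) : coverRadius k ≤ scale k := by
  cases k <;> simp [coverRadius]

lemma joinRadius_succ (k : ℕ) : joinRadius (k + 1) = numSteps k * scale k := by
  simp only [joinRadius, coverRadius, numSteps]
  rw [scale_succ]
  ring

lemma joinRadius_le (k : ℕ) : joinRadius k ≤ 3 * scale k := by
  have := coverRadius_le k
  unfold joinRadius
  omega

lemma pathLen_succ (k : ℕ) : pathLen (k + 1) = numSteps k * pathLen k := by
  simp only [pathLen, numSteps]
  rw [scale_succ]
  ring

lemma six_mul_pathLen_le (k : ℕ) : 6 * pathLen k ≤ pathLen (k + 1) := by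
  rw [pathLen_succ]
  refine Nat.mul_le_mul_right _ ?_
  have : 2 ≤ 2 ^ (2 * k + 1) := Nat.le_self_pow (by omega) 2
  unfold numSteps
  omega

lemma two_mul_scale_le_pathLen (k : ℕ) : 2 * scale k ≤ pathLen k := by
  unfold pathLen
  have : 1 ≤ 3 ^ k := Nat.one_le_pow _ _ (by omega)
  nlinarith [scale_pos k]

lemma two_le_pathLen (k : ℕ) : 2 ≤ pathLen k := by
  have := two_mul_scale_le_pathLen k
  have := scale_pos k
  omega

lemma pathLen_mono : Monotone pathLen :=
  monotone_nat_of_le_succ fun k => by have := six_mul_pathLen_le k; omega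

section
variable {d : ℕ}

/-- The site reached from the origin after `n` steps of length at most `m` towards `w`. -/
noncomputable def waypoint (m : ℕ) (w : Site d) : ℕ → Site d
  | 0 => 0
  | n + 1 => waypoint m w n + (exists_l1_step m (w - waypoint m w n)).choose

lemma l1_waypoint_succ_sub (m : ℕ) (w : Site d) (n : ℕ) :
    l1 (waypoint m w (n + 1) - waypoint m w n) ≤ m := by
  rw [waypoint, add_sub_cancel_left]
  exact (exists_l1_step m (w - waypoint m w n)).choose_spec.1

lemma l1_sub_waypoint (m : ℕ) (w : Site d) (n : ℕ) : l1 (w - waypoint m w n) ≤ l1 w - n * m := by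
  induction n with
  | zero => simp [waypoint]
  | succ n ih =>
    have := (exists_l1_step m (w - waypoint m w n)).choose_spec.2
    rw [waypoint, ← sub_sub]
    refine this.trans ?_
    rw [add_mul]
    omega

lemma waypoint_eq {m n : ℕ} {w : Site d} (h : l1 w ≤ n * m) : waypoint m w n = w := by
  have := l1_sub_waypoint m w n
  exact (sub_eq_zero.mp (l1_eq_zero.mp (by omega))).symm

lemma l1_waypoint_le (m : ℕ) (w : Site d) (n : ℕ) : l1 (waypoint m w n) ≤ n * m := by
  induction n with
  | zero => simp [waypoint]
  | succ n ih =>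
    have h1 := l1_waypoint_succ_sub m w n
    have h2 := l1_sub_le (waypoint m w (n + 1)) (waypoint m w n) 0
    simp only [sub_zero] at h2
    rw [add_mul]
    omega

/-- A fixed element of a set (and a default value for the empty set). Since it depends on the set
only, choices made with it inherit the symmetries of the set. -/
noncomputable def pick {α : Type*} [Inhabited α] (A : Set α) : α :=
  open Classical in if h : A.Nonempty then h.some else default

lemma pick_mem {α : Type*} [Inhabited α] {A : Set α} (h : A.Nonempty) : pick A ∈ A := by
  unfold pick
  rw [dif_pos h]
  exact h.some_mem

/-- The hubs of level `k`. Among the hubs of level `k`, those whose mark `β` is at least `k + 1` are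
hubs of level `k + 1`, and so are those in holes of the set of sites with such a mark. -/
def hubs (β : Site d → ℕ) : ℕ → Set (Site d)
  | 0 => Set.univ
  | k + 1 => {v | v ∈ hubs β k ∧
      (k + 1 ≤ β v ∨ ∀ w, l1 w ≤ scale (k + 1) / 2 → β (v + w) < k + 1)}

lemma mem_hubs_of_le {β : Site d → ℕ} {k : ℕ} {v : Site d} (h : k ≤ β v) : v ∈ hubs β k := by
  induction k with
  | zero => trivial
  | succ k ih => exact ⟨ih (by omega), Or.inl h⟩

lemma hubs_succ_subset (β : Site d → ℕ) (k : ℕ) : hubs β (k + 1) ⊆ hubs β k := fun _ h => h.1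

lemma exists_hub (β : Site d → ℕ) (k : ℕ) (v : Site d) :
    ∃ w, l1 w ≤ coverRadius k ∧ v + w ∈ hubs β k := by
  induction k with
  | zero => exact ⟨0, by simp, trivial⟩
  | succ k ih =>
    obtain ⟨w, hw, hh⟩ := ih
    have h1 := coverRadius_le k
    have h2 := two_mul_scale_le k
    have h3 := scale_pos k
    simp only [coverRadius]
    by_cases h : ∃ w', l1 w' ≤ scale (k + 1) / 2 ∧ k + 1 ≤ β (v + w + w')
    · obtain ⟨w', hw', hβ⟩ := h
      refine ⟨w + w', (l1_add_le _ _).trans (by omega), ?_⟩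
      rw [← add_assoc]
      exact mem_hubs_of_le hβ
    · push Not at h
      exact ⟨w, by omega, hh, Or.inr h⟩

/-- A hub of level `k` close to `v`, and `v` itself if `v` is a hub. -/
noncomputable def nearHub (β : Site d → ℕ) (k : ℕ) (v : Site d) : Site d :=
  v + pick {w | l1 w ≤ coverRadius k ∧ v + w ∈ hubs β k ∧ (v ∈ hubs β k → w = 0)}

lemma nearHub_spec (β : Site d → ℕ) (k : ℕ) (v : Site d) :
    l1 (nearHub β k v - v) ≤ coverRadius k ∧ nearHub β k v ∈ hubs β k ∧
      (v ∈ hubs β k → nearHub β k v = v) := by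
  have hne : {w | l1 w ≤ coverRadius k ∧ v + w ∈ hubs β k ∧ (v ∈ hubs β k → w = 0)}.Nonempty := by
    by_cases h : v ∈ hubs β k
    · exact ⟨0, by simpa using h⟩
    · obtain ⟨w, h1, h2⟩ := exists_hub β k v
      exact ⟨w, h1, h2, fun h' => absurd h' h⟩
  obtain ⟨h1, h2, h3⟩ := pick_mem hne
  exact ⟨by rwa [nearHub, add_sub_cancel_left], h2, fun h => by rw [nearHub, h3 h, add_zero]⟩

/-- The `i`-th of the hubs of level `k` along a line from `s` to `t`. -/
noncomputable def hubAlong (β : Site d → ℕ) (k : ℕ) (s t : Site d) (i : ℕ) : Site d :=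
  nearHub β k (s + waypoint (scale k) (t - s) i)

lemma hubAlong_mem (β : Site d → ℕ) (k : ℕ) (s t : Site d) (i : ℕ) :
    hubAlong β k s t i ∈ hubs β k := (nearHub_spec β k _).2.1

lemma hubAlong_zero {β : Site d → ℕ} {k : ℕ} {s t : Site d} (hs : s ∈ hubs β k) :
    hubAlong β k s t 0 = s := by
  have : s + waypoint (scale k) (t - s) 0 = s := by simp [waypoint]
  rw [hubAlong, this, (nearHub_spec β k s).2.2 hs]

lemma hubAlong_numSteps {β : Site d → ℕ} {k : ℕ} {s t : Site d} (ht : t ∈ hubs β k)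
    (h : l1 (t - s) ≤ joinRadius (k + 1)) : hubAlong β k s t (numSteps k) = t := by
  rw [joinRadius_succ] at h
  rw [hubAlong, waypoint_eq h, add_sub_cancel, (nearHub_spec β k t).2.2 ht]

lemma l1_hubAlong_succ_sub (β : Site d → ℕ) (k : ℕ) (s t : Site d) (i : ℕ) :
    l1 (hubAlong β k s t (i + 1) - hubAlong β k s t i) ≤ joinRadius k := by
  set a := s + waypoint (scale k) (t - s) i with ha
  set b := s + waypoint (scale k) (t - s) (i + 1) with hb
  have h1 := (nearHub_spec β k a).1
  have h2 := (nearHub_spec β k b).1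
  have h3 : l1 (b - a) ≤ scale k := by
    rw [ha, hb, add_sub_add_left_eq_sub]
    exact l1_waypoint_succ_sub _ _ _
  have h4 := l1_sub_le (nearHub β k b) b (nearHub β k a)
  have h5 := l1_sub_le b a (nearHub β k a)
  rw [l1_sub_comm a] at h5
  simp only [hubAlong, joinRadius, ← ha, ← hb]
  omega

/-- The vertices on the path of level `k` from `s` to `t`: a path of level `k + 1` is a
concatenation of paths of level `k`. -/
noncomputable def hubPath (β : Site d → ℕ) : ℕ → Site d → Site d → Finset (Site d)
  | 0, s, t => {s, t}
  | k + 1, s, t => (Finset.range (numSteps k)).biUnion fun i =>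
      hubPath β k (hubAlong β k s t i) (hubAlong β k s t (i + 1))

lemma card_hubPath_le (β : Site d → ℕ) (k : ℕ) (s t : Site d) :
    (hubPath β k s t).card ≤ pathLen k := by
  induction k generalizing s t with
  | zero =>
    refine Finset.card_le_two.trans ?_
    simp [pathLen, scale]
  | succ k ih =>
    rw [hubPath, pathLen_succ]
    refine (Finset.card_biUnion_le_card_mul _ _ _ fun i _ => ih _ _).trans_eq ?_
    rw [Finset.card_range]

/-- `Walk A n u v`: there is a walk of length `n` in `A` from `u` to `v`. -/
inductive Walk (A : Set (Site d)) : ℕ → Site d → Site d → Prop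
  | nil {u : Site d} (hu : u ∈ A) : Walk A 0 u u
  | cons {n : ℕ} {u v w : Site d} (hu : u ∈ A) (huv : l1 (v - u) ≤ 1) (h : Walk A n v w) :
      Walk A (n + 1) u w

namespace Walk
variable {A B : Set (Site d)} {n m : ℕ} {u v w : Site d}

lemma mem_left (h : Walk A n u v) : u ∈ A := by cases h <;> assumption

lemma mono (hAB : A ⊆ B) (h : Walk A n u v) : Walk B n u v := by
  induction h with
  | nil hu => exact nil (hAB hu)
  | cons hu huv _ ih => exact cons (hAB hu) huv ih

lemma trans (h : Walk A n u v) (h' : Walk A m v w) : Walk A (n + m) u w := by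
  induction h with
  | nil _ => simpa using h'
  | cons hu huv _ ih =>
    rw [add_right_comm]
    exact cons hu huv (ih h')

lemma l1_le (h : Walk A n u v) : l1 (v - u) ≤ n := by
  induction h with
  | nil _ => simp
  | @cons n u v w _ huv _ ih =>
    have := l1_sub_le w v u
    omega

end Walk

lemma hubPath_zero_walk (β : Site d → ℕ) {s t : Site d} (h : l1 (t - s) ≤ 1) {u : Site d}
    (hu : u ∈ hubPath β 0 s t) : ∃ n ≤ 1, Walk (hubPath β 0 s t : Set (Site d)) n u t := by
  have ht : t ∈ (hubPath β 0 s t : Set (Site d)) := by simp [hubPath]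
  have hs : s ∈ (hubPath β 0 s t : Set (Site d)) := by simp [hubPath]
  simp only [hubPath, Finset.mem_insert, Finset.mem_singleton] at hu
  rcases hu with rfl | rfl
  · exact ⟨1, le_rfl, Walk.cons hs h (Walk.nil ht)⟩
  · exact ⟨0, by omega, Walk.nil ht⟩

/-- If the paths of level `k` are connected, then so are the paths of level `k + 1`. -/
lemma hubPath_succ_walk {β : Site d → ℕ} {k : ℕ}
    (ih : ∀ s ∈ hubs β k, ∀ t ∈ hubs β k, l1 (t - s) ≤ joinRadius k →
      s ∈ hubPath β k s t ∧ ∀ u ∈ hubPath β k s t,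
        ∃ n ≤ pathLen k, Walk (hubPath β k s t : Set (Site d)) n u t)
    {s t : Site d} (hs : s ∈ hubs β k) (ht : t ∈ hubs β k) (h : l1 (t - s) ≤ joinRadius (k + 1)) :
    s ∈ hubPath β (k + 1) s t ∧ ∀ u ∈ hubPath β (k + 1) s t,
      ∃ n ≤ pathLen (k + 1), Walk (hubPath β (k + 1) s t : Set (Site d)) n u t := by
  have hN : 0 < numSteps k := by unfold numSteps; positivity
  have hsub : ∀ i < numSteps k, (hubPath β k (hubAlong β k s t i) (hubAlong β k s t (i + 1)) :
      Set (Site d)) ⊆ hubPath β (k + 1) s t := by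
    intro i hi u hu
    rw [hubPath, Finset.mem_coe, Finset.mem_biUnion]
    exact ⟨i, Finset.mem_range.mpr hi, hu⟩
  have ih' := fun i => ih _ (hubAlong_mem β k s t i) _ (hubAlong_mem β k s t (i + 1))
    (l1_hubAlong_succ_sub β k s t i)
  -- walks to `t` that start in the piece with `j` pieces after it
  have hlast : ∀ j ≤ numSteps k, ∀ i, i + (j + 1) = numSteps k →
      ∀ u ∈ hubPath β k (hubAlong β k s t i) (hubAlong β k s t (i + 1)),
      ∃ n ≤ (j + 1) * pathLen k, Walk (hubPath β (k + 1) s t : Set (Site d)) n u t := by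
    intro j
    induction j with
    | zero =>
      intro _ i hi u hu
      obtain ⟨n, hn, hw⟩ := (ih' i).2 u hu
      rw [zero_add] at hi
      rw [hi, hubAlong_numSteps ht h] at hw
      refine ⟨n, by omega, hw.mono ?_⟩
      have := hsub i (by omega)
      rwa [hi, hubAlong_numSteps ht h] at this
    | succ j ihj =>
      intro hj i hi u hu
      obtain ⟨n, hn, hw⟩ := (ih' i).2 u hu
      obtain ⟨m, hm, hw'⟩ := ihj (by omega) (i + 1) (by omega) _ (ih' (i + 1)).1
      refine ⟨n + m, ?_, (hw.mono (hsub i (by omega))).trans hw'⟩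
      rw [add_mul _ 1, one_mul]
      omega
  constructor
  · have := hsub 0 hN (ih' 0).1
    rwa [hubAlong_zero hs] at this
  · intro u hu
    rw [hubPath, Finset.mem_biUnion] at hu
    obtain ⟨i, hi, hu⟩ := hu
    rw [Finset.mem_range] at hi
    obtain ⟨n, hn, hw⟩ := hlast (numSteps k - i - 1) (by omega) i (by omega) u hu
    refine ⟨n, hn.trans ?_, hw⟩
    rw [pathLen_succ]
    exact Nat.mul_le_mul_right _ (by omega)

lemma hubPath_walk (β : Site d → ℕ) (k : ℕ) :
    ∀ s ∈ hubs β k, ∀ t ∈ hubs β k, l1 (t - s) ≤ joinRadius k →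
      s ∈ hubPath β k s t ∧ ∀ u ∈ hubPath β k s t,
        ∃ n ≤ pathLen k, Walk (hubPath β k s t : Set (Site d)) n u t := by
  induction k with
  | zero =>
    intro s _ t _ h
    refine ⟨by simp [hubPath], fun u hu => ?_⟩
    obtain ⟨n, hn, hw⟩ := hubPath_zero_walk β (by simpa [joinRadius, scale, coverRadius] using h) hu
    exact ⟨n, hn.trans (by simp [pathLen, scale]), hw⟩
  | succ k ih =>
    intro s hs t ht h
    exact hubPath_succ_walk ih (hubs_succ_subset β k hs) (hubs_succ_subset β k ht) h

/-! ### The skeletons -/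

/-- The skeleton of level `k`: the union of the paths of level `k`. -/
def skeleton (β : Site d → ℕ) (k : ℕ) : Set (Site d) :=
  {u | ∃ s ∈ hubs β k, ∃ t ∈ hubs β k, l1 (t - s) ≤ joinRadius k ∧ u ∈ hubPath β k s t}

lemma hubs_subset_skeleton (β : Site d → ℕ) (k : ℕ) : hubs β k ⊆ skeleton β k := fun s hs =>
  ⟨s, hs, s, hs, by simp, (hubPath_walk β k s hs s hs (by simp)).1⟩

lemma skeleton_zero (β : Site d → ℕ) : skeleton β 0 = Set.univ :=
  Set.eq_univ_of_univ_subset (hubs_subset_skeleton β 0)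

lemma hubPath_succ_subset_skeleton (β : Site d → ℕ) (k : ℕ) (s t : Site d) :
    (hubPath β (k + 1) s t : Set (Site d)) ⊆ skeleton β k := by
  intro u hu
  rw [hubPath, Finset.mem_coe, Finset.mem_biUnion] at hu
  obtain ⟨i, -, hu⟩ := hu
  exact ⟨_, hubAlong_mem β k s t i, _, hubAlong_mem β k s t (i + 1),
    l1_hubAlong_succ_sub β k s t i, hu⟩

lemma skeleton_antitone (β : Site d → ℕ) : Antitone (skeleton β) :=
  antitone_nat_of_succ_le fun k _ ⟨s, _, t, _, _, hu⟩ => hubPath_succ_subset_skeleton β k s t hu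

lemma exists_walk_to_skeleton {β : Site d → ℕ} {k : ℕ} {u : Site d} (hu : u ∈ skeleton β k) :
    ∃ n ≤ 2 * pathLen (k + 1), ∃ v ∈ skeleton β (k + 1), Walk (skeleton β k) n u v := by
  obtain ⟨s, hs, t, ht, hst, hup⟩ := hu
  obtain ⟨n, hn, hw⟩ := (hubPath_walk β k s hs t ht hst).2 u hup
  obtain ⟨w, hw', hub⟩ := exists_hub β (k + 1) t
  have hjoin : l1 (t + w - t) ≤ joinRadius (k + 1) := by
    rw [add_sub_cancel_left]
    unfold joinRadius
    omega
  obtain ⟨h1, h2⟩ := hubPath_succ_walk (hubPath_walk β k) ht (hubs_succ_subset β k hub) hjoin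
  obtain ⟨m, hm, hwm⟩ := h2 t h1
  have hle := pathLen_mono (Nat.le_succ k)
  rw [Nat.succ_eq_add_one] at hle
  refine ⟨n + m, by omega, t + w, hubs_subset_skeleton β (k + 1) hub, Walk.trans (hw.mono ?_)
    (hwm.mono (hubPath_succ_subset_skeleton β k _ _))⟩
  exact fun u hu => ⟨s, hs, t, ht, hst, hu⟩

/-- The distance, inside the skeleton of level `k`, to the skeleton of level `k + 1`. -/
noncomputable def height (β : Site d → ℕ) (k : ℕ) (u : Site d) : ℕ :=
  sInf {n | ∃ v ∈ skeleton β (k + 1), Walk (skeleton β k) n u v}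

lemma height_spec {β : Site d → ℕ} {k : ℕ} {u : Site d} (hu : u ∈ skeleton β k) :
    height β k u ≤ 2 * pathLen (k + 1) ∧
      ∃ v ∈ skeleton β (k + 1), Walk (skeleton β k) (height β k u) u v := by
  obtain ⟨n, hn, hex⟩ := exists_walk_to_skeleton hu
  exact ⟨(Nat.sInf_le hex).trans hn,
    Nat.sInf_mem (s := {n | ∃ v ∈ skeleton β (k + 1), Walk (skeleton β k) n u v}) ⟨n, hex⟩⟩

lemma exists_height_lt {β : Site d → ℕ} {k : ℕ} {u : Site d} (hu : u ∈ skeleton β k)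
    (hu' : u ∉ skeleton β (k + 1)) :
    ∃ e, l1 e ≤ 1 ∧ u + e ∈ skeleton β k ∧ height β k (u + e) < height β k u := by
  obtain ⟨-, v, hv, hw⟩ := height_spec hu
  generalize hh : height β k u = n at hw
  cases hw with
  | nil _ => exact absurd hv hu'
  | @cons n _ w _ _ huw h =>
    refine ⟨w - u, huw, ?_, ?_⟩
    · rw [add_sub_cancel]
      exact h.mem_left
    · rw [add_sub_cancel]
      exact Nat.lt_succ_of_le (Nat.sInf_le ⟨v, hv, h⟩)

/-- The parent of a vertex that is in the skeleton of level `k` but not of level `k + 1`: the next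
vertex on the way to the latter. (A vertex of all skeletons is its own parent.) -/
noncomputable def parent (β : Site d → ℕ) (u : Site d) : Site d :=
  u + pick {e | l1 e ≤ 1 ∧ ∃ k, u ∈ skeleton β k ∧ u ∉ skeleton β (k + 1) ∧
    u + e ∈ skeleton β k ∧ height β k (u + e) < height β k u}

lemma parent_spec {β : Site d → ℕ} {k : ℕ} {u : Site d} (hu : u ∈ skeleton β k)
    (hu' : u ∉ skeleton β (k + 1)) :
    l1 (parent β u - u) ≤ 1 ∧ parent β u ∈ skeleton β k ∧
      height β k (parent β u) < height β k u := by
  obtain ⟨e, he, h1, h2⟩ := exists_height_lt hu hu'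
  obtain ⟨g1, i, g2, g3, g4, g5⟩ := pick_mem (A := {e | l1 e ≤ 1 ∧ ∃ k, u ∈ skeleton β k ∧
    u ∉ skeleton β (k + 1) ∧ u + e ∈ skeleton β k ∧ height β k (u + e) < height β k u})
    ⟨e, he, k, hu, hu', h1, h2⟩
  obtain rfl : i = k := by
    rcases lt_trichotomy i k with h | h | h
    · exact absurd (skeleton_antitone β h hu) g3
    · exact h
    · exact absurd (skeleton_antitone β h g2) hu'
  exact ⟨by rwa [parent, add_sub_cancel_left], g4, g5⟩

lemma exists_level {β : Site d → ℕ} {k : ℕ} {u : Site d} (hu : u ∉ skeleton β k) :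
    ∃ i < k, u ∈ skeleton β i ∧ u ∉ skeleton β (i + 1) := by
  induction k with
  | zero => exact absurd (by simp [skeleton_zero]) hu
  | succ k ih =>
    by_cases h : u ∈ skeleton β k
    · exact ⟨k, by omega, h, hu⟩
    · obtain ⟨i, hi, h'⟩ := ih h
      exact ⟨i, by omega, h'⟩

lemma parent_eq_self {β : Site d → ℕ} {u : Site d} (h : ∀ k, u ∈ skeleton β k) :
    parent β u = u := by
  have : {e | l1 e ≤ 1 ∧ ∃ k, u ∈ skeleton β k ∧ u ∉ skeleton β (k + 1) ∧
      u + e ∈ skeleton β k ∧ height β k (u + e) < height β k u} = ∅ :=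
    Set.eq_empty_of_forall_notMem fun e ⟨_, k, _, hk, _⟩ => hk (h _)
  rw [parent, this, pick, dif_neg (by simp)]
  exact add_zero u

lemma l1_parent_sub_le (β : Site d → ℕ) (u : Site d) : l1 (parent β u - u) ≤ 1 := by
  by_cases h : ∃ k, u ∉ skeleton β k
  · obtain ⟨k, hk⟩ := h
    obtain ⟨i, -, h1, h2⟩ := exists_level hk
    exact (parent_spec h1 h2).1
  · rw [parent_eq_self (by simpa using h)]
    simp

lemma l1_iterate_parent_sub_le (β : Site d → ℕ) (u : Site d) (n : ℕ) :
    l1 ((parent β)^[n] u - u) ≤ n := by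
  induction n with
  | zero => simp
  | succ n ih =>
    rw [Function.iterate_succ_apply']
    have h1 := l1_sub_le (parent β ((parent β)^[n] u)) ((parent β)^[n] u) u
    have h2 := l1_parent_sub_le β ((parent β)^[n] u)
    omega

lemma parent_mem_skeleton {β : Site d → ℕ} {k : ℕ} {u : Site d} (hu : u ∈ skeleton β k) :
    parent β u ∈ skeleton β k := by
  by_cases h : ∃ i, u ∉ skeleton β i
  · obtain ⟨i, hi⟩ := h
    obtain ⟨i, -, h1, h2⟩ := exists_level hi
    have : k ≤ i := by
      by_contra hlt
      exact h2 (skeleton_antitone β (by omega) hu)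
    exact skeleton_antitone β this (parent_spec h1 h2).2.1
  · rwa [parent_eq_self (by simpa using h)]

lemma iterate_parent_mem_skeleton {β : Site d → ℕ} {k : ℕ} {u : Site d} (hu : u ∈ skeleton β k)
    (n : ℕ) : (parent β)^[n] u ∈ skeleton β k := by
  induction n generalizing u with
  | zero => exact hu
  | succ n ih => exact ih (parent_mem_skeleton hu)

lemma le_height_of_iterate {β : Site d → ℕ} {k : ℕ} {u : Site d} (hu : u ∈ skeleton β k) (n : ℕ)
    (hn : (parent β)^[n] u ∉ skeleton β (k + 1)) : n ≤ height β k u := by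
  induction n generalizing u with
  | zero => omega
  | succ n ih =>
    have hu' : u ∉ skeleton β (k + 1) := fun h => hn (iterate_parent_mem_skeleton h _)
    obtain ⟨-, h1, h2⟩ := parent_spec hu hu'
    have := ih h1 hn
    omega

/-- Chains of parents that end outside the skeleton of level `k` are short. -/
lemma length_le_of_iterate_parent {β : Site d → ℕ} {k : ℕ} {u : Site d} {n : ℕ}
    (h : (parent β)^[n] u ∉ skeleton β k) : n ≤ 4 * pathLen k := by
  induction k generalizing u n with
  | zero => exact absurd (by simp [skeleton_zero]) h
  | succ k ih =>
    have hle := six_mul_pathLen_le k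
    have hpos : 2 * scale k ≤ pathLen k := two_mul_scale_le_pathLen k
    have hsc := scale_pos k
    by_cases hex : ∃ m ≤ n, (parent β)^[m] u ∈ skeleton β k
    · classical
      set m := Nat.find hex with hm
      obtain ⟨hmn, hmem⟩ := Nat.find_spec hex
      have h1 : n - m ≤ height β k ((parent β)^[m] u) := by
        refine le_height_of_iterate hmem _ ?_
        rwa [← Function.iterate_add_apply, Nat.sub_add_cancel hmn]
      have h2 := (height_spec hmem).1
      have h3 : m ≤ 4 * pathLen k + 1 := by
        rcases Nat.eq_zero_or_pos m with h0 | h0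
        · omega
        · have := Nat.find_min hex (m := m - 1) (by omega)
          have := ih (u := u) (n := m - 1) fun hh => this ⟨by omega, hh⟩
          omega
      rw [← hm] at h2
      omega
    · push Not at hex
      have := ih (hex n le_rfl)
      omega

end

/-! ### Perfect matchings from forests with finite pasts -/

section
variable {α : Type*}

/-- The descendants of `v` in the forest with parent function `p`, including `v` itself. -/
def past (p : α → α) (v : α) : Set α := {u | ∃ n, p^[n] u = v}

/-- The vertex around which `v` is matched: the parent of `v` if the number of descendants of `v` is
odd (so that `v` is left over by its descendants), and `v` itself otherwise. -/
noncomputable def host (p : α → α) (v : α) : α :=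
  open Classical in if Odd (past p v).ncard then p v else v

/-- The number of vertices with a given host is even: the children that are left over by their
descendants, and the vertex itself if the number of these children is odd. -/
lemma even_ncard_host_fiber {p : α → α} (hfin : ∀ v, (past p v).Finite)
    (hac : ∀ v n, p^[n + 1] v ≠ v) (q : α) :
    {v | host p v = q}.Finite ∧ Even {v | host p v = q}.ncard := by
  classical
  have hself : ∀ v, v ∈ past p v := fun v => ⟨0, rfl⟩
  have hCfin : {c | p c = q}.Finite := (hfin q).subset fun c hc => ⟨1, hc⟩
  set C := hCfin.toFinset with hC
  have hmemC : ∀ c, c ∈ C ↔ p c = q := by simp [hC]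
  set P : α → Finset α := fun v => (hfin v).toFinset with hP
  have hmemP : ∀ u v, u ∈ P v ↔ ∃ n, p^[n] u = v := by
    intro u v
    simp [hP, past]
  have hcard : ∀ v, (past p v).ncard = (P v).card := fun v =>
    Set.ncard_eq_toFinset_card _ (hfin v)
  -- a vertex has at most one child of `q` among its ancestors
  have hlt : ∀ c c' n m u, p c = q → p c' = q → p^[n] u = c → p^[m] u = c' → ¬ n < m := by
    intro c c' n m u hc hc' hn hm hlt
    obtain ⟨t, rfl⟩ : ∃ t, m = (t + 1) + n := ⟨m - n - 1, by omega⟩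
    rw [Function.iterate_add_apply, hn, Function.iterate_succ_apply, hc] at hm
    apply hac q t
    rw [Function.iterate_succ_apply', hm, hc']
  have hdisj : ∀ c ∈ C, ∀ c' ∈ C, c ≠ c' → Disjoint (P c) (P c') := by
    intro c hc c' hc' hne
    rw [hmemC] at hc hc'
    rw [Finset.disjoint_left]
    intro u hu hu'
    rw [hmemP] at hu hu'
    obtain ⟨n, hn⟩ := hu
    obtain ⟨m, hm⟩ := hu'
    rcases lt_trichotomy n m with h | rfl | h
    · exact hlt c c' n m u hc hc' hn hm h
    · exact hne (hn.symm.trans hm)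
    · exact hlt c' c m n u hc' hc hm hn h
  have hq : q ∉ C.biUnion P := by
    rw [Finset.mem_biUnion]
    rintro ⟨c, hc, hqc⟩
    rw [hmemC] at hc
    obtain ⟨n, hn⟩ := (hmemP _ _).mp hqc
    apply hac q n
    rw [Function.iterate_succ_apply', hn, hc]
  have hunion : P q = insert q (C.biUnion P) := by
    ext u
    rw [Finset.mem_insert, Finset.mem_biUnion, hmemP]
    constructor
    · rintro ⟨n, hn⟩
      cases n with
      | zero => exact Or.inl hn
      | succ n =>
        rw [Function.iterate_succ_apply'] at hn
        exact Or.inr ⟨p^[n] u, (hmemC _).mpr hn, (hmemP _ _).mpr ⟨n, rfl⟩⟩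
    · rintro (rfl | ⟨c, hc, hu⟩)
      · exact ⟨0, rfl⟩
      · obtain ⟨n, hn⟩ := (hmemP _ _).mp hu
        exact ⟨n + 1, by rw [Function.iterate_succ_apply', hn, (hmemC c).mp hc]⟩
  have hsum : (P q).card = (∑ c ∈ C, (P c).card) + 1 := by
    rw [hunion, Finset.card_insert_of_notMem hq, Finset.card_biUnion hdisj]
  -- the children of `q` that are left over by their descendants
  set L := {c ∈ C | Odd (P c).card} with hL
  have hpar : Odd (P q).card ↔ Even L.card := by
    rw [hsum, Nat.odd_add_one, Finset.odd_sum_iff_odd_card_odd, Nat.not_odd_iff_even]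
  have hpq : p q ≠ q := hac q 0
  have hset : {v | host p v = q} =
      ((if Odd (P q).card then L else insert q L : Finset α) : Set α) := by
    ext v
    simp only [host, hcard, Set.mem_ofPred_eq, Finset.mem_coe]
    by_cases hv : v = q
    · subst hv
      split_ifs with h <;> simp [hL, hmemC, hpq]
    · split_ifs with h1 h2 h2
      · simp [hL, hmemC, h1]
      · simp [hL, hmemC, h1, hv]
      · simp [hL, h1, hv]
      · simp [hL, h1, hv]
  rw [hset, Set.ncard_coe_finset]
  refine ⟨Finset.finite_toSet _, ?_⟩
  split_ifs with h
  · exact hpar.mp h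
  · rw [Finset.card_insert_of_notMem (by simp [hL, hmemC, hpq]), Nat.even_add_one]
    exact fun h' => h (hpar.mpr h')

/-- A fixed-point-free involution of `G`, if there is one. It depends on the set `G` only. -/
noncomputable def pairing (G : Set α) : α → α :=
  open Classical in
  if h : ∃ g : α → α, ∀ a ∈ G, g a ∈ G ∧ g a ≠ a ∧ g (g a) = a then h.choose else id

lemma pairing_spec {G : Set α} (hG : G.Finite) (heven : Even G.ncard) :
    ∀ a ∈ G, pairing G a ∈ G ∧ pairing G a ≠ a ∧ pairing G (pairing G a) = a := by
  classical
  have h : ∃ g : α → α, ∀ a ∈ G, g a ∈ G ∧ g a ≠ a ∧ g (g a) = a := by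
    obtain ⟨m, hm⟩ := heven
    have := hG.to_subtype
    obtain ⟨e⟩ : Nonempty (G ≃ Fin m × Bool) := by
      rw [← Finite.card_eq, Nat.card_coe_set_eq, hm]
      simp [mul_two]
    set g : G → G := fun a => e.symm ((e a).1, !(e a).2) with hg
    have hgg : ∀ a, g (g a) = a := by
      intro a
      simp [hg]
    have hne : ∀ a, g a ≠ a := by
      intro a ha
      have := congrArg (fun b => (e b).2) ha
      simp [hg] at this
    refine ⟨fun a => if h : a ∈ G then (g ⟨a, h⟩).1 else a, fun a ha => ?_⟩
    simp only [ha, dif_pos]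
    refine ⟨(g ⟨a, ha⟩).2, fun h => hne ⟨a, ha⟩ (Subtype.ext h), ?_⟩
    rw [dif_pos (g ⟨a, ha⟩).2]
    exact congrArg Subtype.val (hgg ⟨a, ha⟩)
  unfold pairing
  rw [dif_pos h]
  exact h.choose_spec

end

section
variable {d : ℕ}

/-- The direction in which `v` is matched: the vertices with the same host as `v`, in coordinates
relative to the host, are paired up by `pairing`. -/
noncomputable def matchVec (β : Site d → ℕ) (v : Site d) : Site d :=
  pairing {e | host (parent β) (host (parent β) v + e) = host (parent β) v}
    (v - host (parent β) v) - (v - host (parent β) v)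

lemma l1_host_sub_le (β : Site d → ℕ) (v : Site d) : l1 (host (parent β) v - v) ≤ 1 := by
  unfold host
  split_ifs
  · exact l1_parent_sub_le β v
  · simp

/-- If no vertex is in all skeletons, then `matchVec` is a perfect matching. -/
lemma matchVec_spec {β : Site d → ℕ} (hβ : ∀ v, ∃ k, v ∉ skeleton β k) (v : Site d) :
    (diagGrid d).Adj 0 (matchVec β v) ∧ matchVec β (v + matchVec β v) = -matchVec β v := by
  have hfin : ∀ v, (past (parent β) v).Finite := by
    intro v
    obtain ⟨k, hk⟩ := hβ v
    refine ((finite_l1_le d (4 * pathLen k)).image (v - ·)).subset ?_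
    rintro u ⟨n, rfl⟩
    exact ⟨_, (l1_iterate_parent_sub_le β u n).trans (length_le_of_iterate_parent hk),
      sub_sub_cancel _ _⟩
  have hac : ∀ v n, (parent β)^[n + 1] v ≠ v := by
    intro v n h
    obtain ⟨k, hk⟩ := hβ v
    have hfix : (parent β)^[(n + 1) * (4 * pathLen k + 1)] v = v := by
      rw [Function.iterate_mul]
      exact Function.iterate_fixed h _
    have := length_le_of_iterate_parent (n := (n + 1) * (4 * pathLen k + 1)) (by rwa [hfix])
    nlinarith
  set q := host (parent β) v with hq
  set G := {e | host (parent β) (q + e) = q} with hG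
  obtain ⟨hF, hE⟩ := even_ncard_host_fiber hfin hac q
  have himg : {u | host (parent β) u = q} = (q + ·) '' G := by
    ext u
    simp only [Set.mem_image, hG, Set.mem_ofPred_eq]
    exact ⟨fun h => ⟨u - q, by rwa [add_sub_cancel], add_sub_cancel _ _⟩,
      by rintro ⟨e, he, rfl⟩; exact he⟩
  have hinj : Function.Injective (q + · : Site d → Site d) := add_right_injective q
  rw [himg, Set.ncard_image_of_injective _ hinj] at hE
  rw [himg, Set.finite_image_iff hinj.injOn] at hF
  have hv : v - q ∈ G := by
    simp only [hG, Set.mem_ofPred_eq, add_sub_cancel]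
    exact hq.symm
  obtain ⟨h1, h2, h3⟩ := pairing_spec hF hE (v - q) hv
  have hvec : matchVec β v = pairing G (v - q) - (v - q) := rfl
  have hG1 : ∀ e ∈ G, l1 e ≤ 1 := by
    intro e he
    have := l1_host_sub_le β (q + e)
    rw [show host (parent β) (q + e) = q from he] at this
    rwa [sub_add_cancel_left, l1_neg] at this
  have hnew : v + matchVec β v = q + pairing G (v - q) := by
    rw [hvec]
    abel
  refine ⟨⟨?_, ?_⟩, ?_⟩
  · rw [hvec]
    exact (sub_ne_zero.mpr h2).symm
  · have hl : l1 (matchVec β v) ≤ 2 := by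
      rw [hvec]
      have h4 := l1_sub_le (pairing G (v - q)) 0 (v - q)
      rw [sub_zero, zero_sub, l1_neg] at h4
      have h5 := hG1 _ h1
      have h6 := hG1 _ hv
      omega
    unfold l1 at hl
    simp only [Pi.zero_apply, zero_sub, abs_neg]
    zify at hl
    exact hl
  · rw [hnew]
    have hh : host (parent β) (q + pairing G (v - q)) = q := h1
    unfold matchVec
    rw [hh, add_sub_cancel_left]
    change pairing G (pairing G (v - q)) - pairing G (v - q) = -(pairing G (v - q) - (v - q))
    rw [h3]
    abel

end

/-! ### Locality and translation invariance of the construction -/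

section
variable {d : ℕ}

/-- Translated by `c`, the marks `β` in the ball of radius `r` around `v` become the marks `β'`. -/
def Agree (c v : Site d) (r : ℕ) (β β' : Site d → ℕ) : Prop :=
  ∀ u, l1 (u - v) ≤ r → β' (u + c) = β u

lemma Agree.of_le {c v u : Site d} {r r' : ℕ} {β β' : Site d → ℕ} (h : Agree c v r β β')
    (hle : l1 (u - v) + r' ≤ r) : Agree c u r' β β' := fun w hw =>
  h w (by have := l1_sub_le w u v; omega)

lemma Agree.mono {c v : Site d} {r r' : ℕ} {β β' : Site d → ℕ} (h : Agree c v r β β')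
    (hle : r' ≤ r) : Agree c v r' β β' := h.of_le (by simpa using hle)

lemma Agree.symm {c v : Site d} {r : ℕ} {β β' : Site d → ℕ} (h : Agree c v r β β') :
    Agree (-c) (v + c) r β' β := fun u hu => by
  have := h (u + -c) (by convert hu using 2; abel)
  rw [← this]
  congr 1
  abel

lemma Agree.hubs_iff {c v : Site d} {k : ℕ} {β β' : Site d → ℕ} (h : Agree c v (scale k) β β') :
    v + c ∈ hubs β' k ↔ v ∈ hubs β k := by
  induction k with
  | zero => exact Iff.rfl
  | succ k ih =>
    have h1 := two_mul_scale_le k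
    refine and_congr (ih (h.mono (by omega))) (or_congr ?_ (forall₂_congr fun w hw => ?_))
    · rw [h v (by simp)]
    · rw [add_right_comm, h (v + w) (by rw [add_sub_cancel_left]; omega)]

lemma Agree.nearHub_eq {c v : Site d} {k : ℕ} {β β' : Site d → ℕ}
    (h : Agree c v (2 * scale k) β β') : nearHub β' k (v + c) = nearHub β k v + c := by
  have hset : {w | l1 w ≤ coverRadius k ∧ v + c + w ∈ hubs β' k ∧ (v + c ∈ hubs β' k → w = 0)}
      = {w | l1 w ≤ coverRadius k ∧ v + w ∈ hubs β k ∧ (v ∈ hubs β k → w = 0)} := by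
    ext w
    refine and_congr_right fun hw => and_congr ?_ ?_
    · have := coverRadius_le k
      rw [add_right_comm]
      exact (h.of_le (by rw [add_sub_cancel_left]; omega)).hubs_iff
    · rw [(h.mono (by omega)).hubs_iff]
  rw [nearHub, nearHub, hset]
  abel

lemma Agree.hubPath_iff {c s : Site d} {k : ℕ} {β β' : Site d → ℕ}
    (h : Agree c s (12 * scale k) β β') (t u : Site d) :
    u + c ∈ hubPath β' k (s + c) (t + c) ↔ u ∈ hubPath β k s t := by
  induction k generalizing s t with
  | zero => simp [hubPath]
  | succ k ih =>
    have h1 := two_mul_scale_le k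
    have hway : ∀ i ≤ numSteps k, l1 (waypoint (scale k) (t - s) i) ≤ 3 * scale (k + 1) := by
      intro i hi
      refine (l1_waypoint_le _ _ _).trans ((Nat.mul_le_mul_right _ hi).trans ?_)
      rw [← joinRadius_succ]
      exact joinRadius_le _
    have halong : ∀ i ≤ numSteps k,
        hubAlong β' k (s + c) (t + c) i = hubAlong β k s t i + c := by
      intro i hi
      have := hway i hi
      rw [hubAlong, add_sub_add_right_eq_sub, add_right_comm]
      exact (h.of_le (by rw [add_sub_cancel_left]; omega)).nearHub_eq
    simp only [hubPath, Finset.mem_biUnion, Finset.mem_range]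
    refine exists_congr fun i => and_congr_right fun hi => ?_
    rw [halong i hi.le, halong (i + 1) hi]
    refine ih (h.of_le ?_) _
    have h2 := hway i hi.le
    have h3 := (nearHub_spec β k (s + waypoint (scale k) (t - s) i)).1
    have h4 := coverRadius_le k
    have h5 := l1_sub_le (hubAlong β k s t i) (s + waypoint (scale k) (t - s) i) s
    rw [add_sub_cancel_left] at h5
    change l1 (hubAlong β k s t i - _) ≤ _ at h3
    omega

lemma Agree.mem_skeleton {c u : Site d} {k : ℕ} {β β' : Site d → ℕ}
    (h : Agree c u (9 * pathLen k) β β') (hu : u ∈ skeleton β k) : u + c ∈ skeleton β' k := by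
  obtain ⟨s, hs, t, ht, hst, hup⟩ := hu
  obtain ⟨n, hn, hw⟩ := (hubPath_walk β k s hs t ht hst).2 u hup
  have h1 := hw.l1_le
  have h2 := two_mul_scale_le_pathLen k
  have h3 := joinRadius_le k
  have h4 := l1_sub_le s t u
  rw [l1_sub_comm s t] at h4
  exact ⟨s + c, (h.of_le (by omega)).hubs_iff.mpr hs, t + c,
    (h.of_le (by omega)).hubs_iff.mpr ht, by rwa [add_sub_add_right_eq_sub],
    ((h.of_le (by omega)).hubPath_iff t u).mpr hup⟩

lemma Agree.skeleton_iff {c u : Site d} {k : ℕ} {β β' : Site d → ℕ}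
    (h : Agree c u (9 * pathLen k) β β') : u + c ∈ skeleton β' k ↔ u ∈ skeleton β k :=
  ⟨fun hu => by simpa using h.symm.mem_skeleton hu, h.mem_skeleton⟩

lemma Walk.translate {A A' : Set (Site d)} {n : ℕ} {u v c : Site d} (h : Walk A n u v)
    (hA : ∀ w, l1 (w - u) ≤ n → w ∈ A → w + c ∈ A') : Walk A' n (u + c) (v + c) := by
  induction h with
  | nil hu => exact Walk.nil (hA _ (by simp) hu)
  | @cons n u v w hu huv _ ih =>
    refine Walk.cons (hA _ (by simp) hu) (by rwa [add_sub_add_right_eq_sub])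
      (ih fun x hx hxA => hA x ?_ hxA)
    have := l1_sub_le x v u
    omega

lemma Agree.height_le {c u : Site d} {k : ℕ} {β β' : Site d → ℕ}
    (h : Agree c u (11 * pathLen (k + 1)) β β') (hu : u ∈ skeleton β k) :
    height β' k (u + c) ≤ height β k u := by
  obtain ⟨h1, v, hv, hw⟩ := height_spec hu
  have h2 := six_mul_pathLen_le k
  have h3 := hw.l1_le
  refine Nat.sInf_le ⟨v + c, (h.of_le (by omega)).mem_skeleton hv, hw.translate fun w hw hwA => ?_⟩
  exact (h.of_le (by omega)).mem_skeleton hwA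

lemma Agree.height_eq {c u : Site d} {k : ℕ} {β β' : Site d → ℕ}
    (h : Agree c u (11 * pathLen (k + 1)) β β') (hu : u ∈ skeleton β k) :
    height β' k (u + c) = height β k u := by
  refine le_antisymm (h.height_le hu) ?_
  have h2 := six_mul_pathLen_le k
  simpa using h.symm.height_le ((h.mono (by omega)).mem_skeleton hu)

lemma Agree.parent_eq {c u : Site d} {k : ℕ} {β β' : Site d → ℕ}
    (h : Agree c u (12 * pathLen k) β β') (hu : u ∉ skeleton β k) :
    parent β' (u + c) = parent β u + c := by
  have h2 := two_le_pathLen k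
  have hu' : u + c ∉ skeleton β' k := fun hh => hu ((h.mono (by omega)).skeleton_iff.mp hh)
  have hset : {e | l1 e ≤ 1 ∧ ∃ k, u + c ∈ skeleton β' k ∧ u + c ∉ skeleton β' (k + 1) ∧
        u + c + e ∈ skeleton β' k ∧ height β' k (u + c + e) < height β' k (u + c)}
      = {e | l1 e ≤ 1 ∧ ∃ k, u ∈ skeleton β k ∧ u ∉ skeleton β (k + 1) ∧
        u + e ∈ skeleton β k ∧ height β k (u + e) < height β k u} := by
    ext e
    refine and_congr_right fun he => exists_congr fun i => ?_
    rcases le_or_gt k i with hi | hi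
    · exact iff_of_false (fun hh => hu' (skeleton_antitone β' hi hh.1))
        fun hh => hu (skeleton_antitone β hi hh.1)
    · have h3 := pathLen_mono hi
      rw [Nat.succ_eq_add_one] at h3
      have h4 := six_mul_pathLen_le i
      have he' : l1 (u + e - u) ≤ 1 := by rwa [add_sub_cancel_left]
      rw [add_right_comm, (h.mono (by omega)).skeleton_iff, (h.mono (by omega)).skeleton_iff,
        (h.of_le (by omega)).skeleton_iff]
      refine and_congr_right fun h5 => and_congr_right fun _ => and_congr_right fun h6 => ?_
      rw [(h.of_le (by omega)).height_eq h6, (h.mono (by omega)).height_eq h5]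
  rw [parent, parent, hset]
  abel

lemma Agree.iterate_parent {c v : Site d} {k : ℕ} {β β' : Site d → ℕ}
    (h : Agree c v (16 * pathLen k) β β') (hv : v ∉ skeleton β k) {u : Site d} {n : ℕ}
    (hn : (parent β)^[n] u = v) : (parent β')^[n] (u + c) = v + c := by
  induction n generalizing u with
  | zero => rw [← hn]; rfl
  | succ n ih =>
    have hu : u ∉ skeleton β k := fun hu => hv (hn ▸ iterate_parent_mem_skeleton hu _)
    have h1 := l1_iterate_parent_sub_le β u (n + 1)
    have h2 := length_le_of_iterate_parent (n := n + 1) (u := u) (by rwa [hn])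
    rw [hn, l1_sub_comm] at h1
    rw [Function.iterate_succ_apply, (h.of_le (by omega)).parent_eq hu]
    exact ih hn

lemma Agree.past_eq {c v : Site d} {k : ℕ} {β β' : Site d → ℕ}
    (h : Agree c v (16 * pathLen k) β β') (hv : v ∉ skeleton β k) :
    past (parent β') (v + c) = (· + c) '' past (parent β) v := by
  have hv' : v + c ∉ skeleton β' k := fun hh => hv ((h.mono (by omega)).skeleton_iff.mp hh)
  ext u
  constructor
  · rintro ⟨n, hn⟩
    refine ⟨u + -c, ⟨n, ?_⟩, by simp⟩
    simpa using h.symm.iterate_parent hv' hn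
  · rintro ⟨u, ⟨n, hn⟩, rfl⟩
    exact ⟨n, h.iterate_parent hv hn⟩

lemma Agree.host_eq {c v : Site d} {k : ℕ} {β β' : Site d → ℕ}
    (h : Agree c v (16 * pathLen k) β β') (hv : v ∉ skeleton β k) :
    host (parent β') (v + c) = host (parent β) v + c := by
  unfold host
  rw [h.past_eq hv, Set.ncard_image_of_injective _ (add_left_injective c)]
  split_ifs
  · exact (h.mono (r' := 12 * pathLen k) (by omega)).parent_eq hv
  · rfl

lemma host_mem_skeleton {β : Site d → ℕ} {k : ℕ} {v : Site d} (hv : v ∈ skeleton β k) :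
    host (parent β) v ∈ skeleton β k := by
  unfold host
  split_ifs
  · exact parent_mem_skeleton hv
  · exact hv

/-- The vertex `v` and its neighbours are outside the skeleton of level `k`, so that all their
descendants are close. -/
def Resolved (β : Site d → ℕ) (k : ℕ) (v : Site d) : Prop :=
  ∀ e, l1 e ≤ 1 → v + e ∉ skeleton β k

lemma Agree.resolved_iff {c v : Site d} {k : ℕ} {β β' : Site d → ℕ}
    (h : Agree c v (18 * pathLen k) β β') : Resolved β' k (v + c) ↔ Resolved β k v := by
  have h2 := two_le_pathLen k
  refine forall₂_congr fun e he => not_congr ?_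
  rw [add_right_comm]
  exact (h.of_le (by rw [add_sub_cancel_left]; omega)).skeleton_iff

lemma Agree.matchVec_eq {c v : Site d} {k : ℕ} {β β' : Site d → ℕ}
    (h : Agree c v (18 * pathLen k) β β') (hv : Resolved β k v) :
    matchVec β' (v + c) = matchVec β v := by
  have h2 := two_le_pathLen k
  have hv' := h.resolved_iff.mpr hv
  have hhost : host (parent β') (v + c) = host (parent β) v + c :=
    (h.mono (r' := 16 * pathLen k) (by omega)).host_eq
      (by simpa using hv 0 (by simp))
  set q := host (parent β) v with hq
  have hqv : l1 (q - v) ≤ 1 := l1_host_sub_le β v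
  have hq1 : q ∉ skeleton β k := by simpa using hv (q - v) hqv
  have hq2 : q + c ∉ skeleton β' k := by
    have := hv' (q - v) hqv
    rwa [show v + c + (q - v) = q + c by abel] at this
  have hset : {e | host (parent β') (q + c + e) = q + c}
      = {e | host (parent β) (q + e) = q} := by
    ext e
    simp only [Set.mem_ofPred_eq]
    rcases le_or_gt (l1 e) 1 with he | he
    · rw [add_right_comm]
      have hqe : l1 (q + e - v) ≤ 2 := by
        have := l1_sub_le (q + e) q v
        rw [add_sub_cancel_left] at this
        omega
      by_cases hs : q + e ∈ skeleton β k
      · refine iff_of_false (fun hh => hq2 ?_) fun hh => hq1 ?_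
        · rw [← hh]
          exact host_mem_skeleton ((h.of_le (by omega)).mem_skeleton hs)
        · rw [← hh]
          exact host_mem_skeleton hs
      · rw [(h.of_le (by omega)).host_eq hs, add_left_inj]
    · refine iff_of_false (fun hh => ?_) fun hh => ?_
      · have := l1_host_sub_le β' (q + c + e)
        rw [hh, sub_add_cancel_left, l1_neg] at this
        omega
      · have := l1_host_sub_le β (q + e)
        rw [hh, sub_add_cancel_left, l1_neg] at this
        omega
  unfold matchVec
  rw [hhost, hset, add_sub_add_right_eq_sub]

end

/-! ### Random marks -/

/-- The probability that the random mark of a site is at least `k`, up to factors `2 ^ O(k)` the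
inverse of the volume of a ball of radius `scale k`. -/
noncomputable def seedProb (d k : ℕ) : ℝ := (1 / 2) ^ (d * (k * (k - 1)))

lemma seedProb_pos (d k : ℕ) : 0 < seedProb d k := by unfold seedProb; positivity

lemma seedProb_le_one (d k : ℕ) : seedProb d k ≤ 1 := pow_le_one₀ (by norm_num) (by norm_num)

lemma seedProb_antitone (d : ℕ) : Antitone (seedProb d) := fun i j h =>
  pow_le_pow_of_le_one (by norm_num) (by norm_num)
    (Nat.mul_le_mul_left _ (Nat.mul_le_mul h (Nat.sub_le_sub_right h 1)))

/-- The mark of a site with label `u`, so that labels in `(0, seedProb d k)` give marks at least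
`k`. (The label `0`, for which there is no greatest such `k`, gets the mark `0`.) -/
noncomputable def mark (d : ℕ) (u : unitInterval) : ℕ := sInf {k | seedProb d (k + 1) ≤ u}

/-- The random marks given by the labels. -/
noncomputable def marks {d : ℕ} (x : RandomLabels d) (v : Site d) : ℕ := mark d (x v)

lemma le_mark_iff {d k : ℕ} (hd : 1 ≤ d) (hk : 1 ≤ k) (u : unitInterval) :
    k ≤ mark d u ↔ 0 < (u : ℝ) ∧ (u : ℝ) < seedProb d k := by
  unfold mark
  rcases eq_or_lt_of_le u.2.1 with h0 | h0
  · have : {k | seedProb d (k + 1) ≤ u} = ∅ := by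
      ext j
      simp [← h0, seedProb_pos]
    rw [this, Nat.sInf_empty, ← h0]
    simp
    omega
  · have hne : {k | seedProb d (k + 1) ≤ u}.Nonempty := by
      obtain ⟨n, hn⟩ := exists_pow_lt_of_lt_one h0 (by norm_num : (1 / 2 : ℝ) < 1)
      refine ⟨n, le_trans (pow_le_pow_of_le_one (by norm_num) (by norm_num) ?_) hn.le⟩
      rw [Nat.add_sub_cancel]
      exact (Nat.le_mul_of_pos_left n n.succ_pos).trans (Nat.le_mul_of_pos_left _ hd)
    simp only [h0, true_and]
    constructor
    · intro h
      by_contra! hle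
      have := Nat.sInf_le (s := {k | seedProb d (k + 1) ≤ u}) (m := k - 1)
        (by simpa [Nat.sub_add_cancel hk] using hle)
      omega
    · intro h
      by_contra! hlt
      have h1 : seedProb d (sInf {k | seedProb d (k + 1) ≤ u} + 1) ≤ u := Nat.sInf_mem hne
      have h2 := seedProb_antitone d (Nat.succ_le_of_lt hlt)
      rw [Nat.succ_eq_add_one] at h2
      linarith

lemma setOf_le_mark {d k : ℕ} (hd : 1 ≤ d) (hk : 1 ≤ k) :
    {u | k ≤ mark d u} = Set.Ioo (0 : unitInterval)
      ⟨seedProb d k, (seedProb_pos d k).le, seedProb_le_one d k⟩ := by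
  ext u
  exact le_mark_iff hd hk u

lemma measurable_mark {d : ℕ} (hd : 1 ≤ d) : Measurable (mark d) := by
  refine measurable_of_Ici fun k => ?_
  rcases Nat.eq_zero_or_pos k with rfl | hk
  · convert MeasurableSet.univ
    ext
    simp
  · change MeasurableSet {u | k ≤ mark d u}
    rw [setOf_le_mark hd hk]
    exact measurableSet_Ioo

lemma volume_le_mark {d k : ℕ} (hd : 1 ≤ d) (hk : 1 ≤ k) :
    volume {u | k ≤ mark d u} = ENNReal.ofReal (seedProb d k) := by
  rw [setOf_le_mark hd hk, unitInterval.volume_Ioo]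
  simp

section
variable {d : ℕ}

lemma measurable_marks (hd : 1 ≤ d) : Measurable (marks (d := d)) :=
  measurable_pi_lambda _ fun v => (measurable_mark hd).comp (measurable_pi_apply v)

lemma measurableSet_le_mark (hd : 1 ≤ d) (k : ℕ) : MeasurableSet {u | k ≤ mark d u} :=
  measurable_mark hd measurableSet_Ici

lemma iid_le_marks (hd : 1 ≤ d) {k : ℕ} (hk : 1 ≤ k) (v : Site d) :
    iid d {x | k ≤ marks x v} = ENNReal.ofReal (seedProb d k) := by
  have h : {x : RandomLabels d | k ≤ marks x v} =
      Set.pi (({v} : Finset (Site d)) : Set (Site d)) fun _ => {u | k ≤ mark d u} := by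
    ext x
    simp [marks]
  rw [h, iid, Measure.infinitePi_pi _ fun _ _ => measurableSet_le_mark hd k]
  simp [volume_le_mark hd hk]

lemma iid_le_marks_pair (hd : 1 ≤ d) {k : ℕ} (hk : 1 ≤ k) {v w : Site d} (hvw : v ≠ w) :
    iid d {x | k ≤ marks x v ∧ k ≤ marks x w} = ENNReal.ofReal (seedProb d k ^ 2) := by
  classical
  have h : {x : RandomLabels d | k ≤ marks x v ∧ k ≤ marks x w} =
      Set.pi (({v, w} : Finset (Site d)) : Set (Site d)) fun _ => {u | k ≤ mark d u} := by
    ext x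
    simp [marks]
  rw [h, iid, Measure.infinitePi_pi _ fun _ _ => measurableSet_le_mark hd k,
    Finset.prod_pair hvw, volume_le_mark hd hk, ← ENNReal.ofReal_mul (seedProb_pos d k).le, sq]

lemma iid_hole_le (hd : 1 ≤ d) {k : ℕ} (hk : 1 ≤ k) {m T : ℕ} (hm : d * m ≤ T) (v : Site d) :
    iid d {x | ∀ w, l1 w ≤ T → marks x (v + w) < k} ≤
      ENNReal.ofReal ((1 - seedProb d k) ^ m ^ d) := by
  classical
  set B : Finset (Site d) := Fintype.piFinset fun _ => Finset.Ico (0 : ℤ) m with hB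
  have hBT : ∀ w ∈ B, l1 w ≤ T := by
    intro w hw
    rw [hB, Fintype.mem_piFinset] at hw
    refine le_trans ?_ hm
    unfold l1
    refine (Finset.sum_le_card_nsmul _ _ m fun i _ => ?_).trans_eq (by simp)
    have := Finset.mem_Ico.mp (hw i)
    omega
  have h : {x : RandomLabels d | ∀ w, l1 w ≤ T → marks x (v + w) < k} ⊆
      Set.pi ((B.image (v + ·) : Finset (Site d)) : Set (Site d)) fun _ => {u | k ≤ mark d u}ᶜ := by
    intro x hx
    rw [Set.mem_pi]
    intro u hu
    rw [Finset.mem_coe, Finset.mem_image] at hu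
    obtain ⟨w, hw, rfl⟩ := hu
    exact not_le.mpr (hx w (hBT w hw))
  refine (measure_mono h).trans ?_
  rw [iid, Measure.infinitePi_pi _ fun _ _ => (measurableSet_le_mark hd k).compl,
    Finset.prod_const, Finset.card_image_of_injective _ (add_right_injective v),
    prob_compl_eq_one_sub (measurableSet_le_mark hd k), volume_le_mark hd hk,
    ← ENNReal.ofReal_one, ← ENNReal.ofReal_sub _ (seedProb_pos d k).le,
    ← ENNReal.ofReal_pow (by linarith [seedProb_le_one d k])]
  simp [hB]

/-- At high levels, holes are as rare as pairs of seeds. -/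
lemma eventually_iid_hole_le (hd : 1 ≤ d) : ∀ᶠ k : ℕ in atTop, ∀ v : Site d,
    iid d {x | ∀ w, l1 w ≤ scale k / 2 → marks x (v + w) < k} ≤
      ENNReal.ofReal (seedProb d k ^ 2) := by
  have hlim : ∀ᶠ k : ℕ in atTop, (k : ℝ) ^ 2 / 2 ^ k < 1 / (2 * d * 2 ^ (d + 1)) :=
    (tendsto_pow_const_div_const_pow_of_one_lt 2 one_lt_two).eventually_lt_const
      (by have : (0 : ℝ) < d := by exact_mod_cast hd
          positivity)
  filter_upwards [hlim, eventually_ge_atTop (d + 2)] with k hk hkd v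
  -- a box of `m ^ d` sites, which are expected to contain `2 ^ (d * a)` seeds
  obtain ⟨a, rfl⟩ : ∃ a, k = a + 1 + d := ⟨k - 1 - d, by omega⟩
  set m := 2 ^ ((a + 1 + d) ^ 2 - 1 - d) with hm
  have hsq : d + 1 ≤ (a + 1 + d) ^ 2 := by nlinarith
  have hscale : d * m ≤ scale (a + 1 + d) / 2 := by
    have : scale (a + 1 + d) / 2 = 2 ^ d * m := by
      rw [hm, ← pow_add, scale]
      obtain ⟨t, ht⟩ : ∃ t, (a + 1 + d) ^ 2 = t + (d + 1) := ⟨_, (Nat.sub_add_cancel hsq).symm⟩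
      rw [ht, show t + (d + 1) - 1 - d = t by omega, show t + (d + 1) = (d + t) + 1 by ring,
        pow_succ, Nat.mul_div_cancel _ two_pos]
    rw [this]
    exact Nat.mul_le_mul_right _ Nat.lt_two_pow_self.le
  refine (iid_hole_le hd (by omega) hscale v).trans (ENNReal.ofReal_le_ofReal ?_)
  have hpm : seedProb d (a + 1 + d) * (m ^ d : ℕ) = 2 ^ (d * a) := by
    rw [seedProb, hm, Nat.cast_pow, Nat.cast_pow, Nat.cast_ofNat, ← pow_mul, one_div, inv_pow]
    rw [inv_mul_eq_iff_eq_mul₀ (by positivity), ← pow_add]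
    congr 1
    have h1 : (a + 1 + d) ^ 2 - 1 - d = (a + 1 + d) * (a + d) + a := by
      have : (a + 1 + d) ^ 2 = (a + 1 + d) * (a + d) + a + d + 1 := by ring
      omega
    rw [h1, show a + 1 + d - 1 = a + d by omega]
    ring
  have hY : 2 * (d * ((a + 1 + d) * (a + 1 + d - 1))) ≤ 2 ^ (d * a) := by
    have h2 : 2 * d * (a + 1 + d) ^ 2 ≤ 2 ^ a := by
      rw [div_lt_div_iff₀ (by positivity) (by have : (0 : ℝ) < d := by exact_mod_cast hd
                                              positivity), one_mul] at hk
      have h3 : ((a + 1 + d : ℕ) : ℝ) ^ 2 * (2 * d) * 2 ^ (d + 1) < 2 ^ a * 2 ^ (d + 1) := by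
        rw [← pow_add, show a + (d + 1) = a + 1 + d by omega]
        linarith
      have h4 := lt_of_mul_lt_mul_right h3 (by positivity)
      have h5 : (a + 1 + d) ^ 2 * (2 * d) < 2 ^ a := by exact_mod_cast h4
      linarith
    calc 2 * (d * ((a + 1 + d) * (a + 1 + d - 1))) ≤ 2 * d * (a + 1 + d) ^ 2 := by
          rw [sq, mul_assoc]
          gcongr
          omega
      _ ≤ 2 ^ a := h2
      _ ≤ 2 ^ (d * a) := Nat.pow_le_pow_right two_pos (Nat.le_mul_of_pos_left _ hd)
  calc (1 - seedProb d (a + 1 + d)) ^ m ^ d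
      ≤ Real.exp (-seedProb d (a + 1 + d)) ^ m ^ d :=
        pow_le_pow_left₀ (by linarith [seedProb_le_one d (a + 1 + d)])
          (Real.one_sub_le_exp_neg _) _
    _ = Real.exp (-1) ^ 2 ^ (d * a) := by
        rw [← Real.exp_nat_mul, ← Real.exp_nat_mul]
        congr 1
        push_cast at hpm ⊢
        linarith
    _ ≤ (1 / 2) ^ 2 ^ (d * a) := by
        refine pow_le_pow_left₀ (Real.exp_pos _).le ?_ _
        rw [Real.exp_neg, one_div]
        exact inv_anti₀ two_pos (by linarith [Real.add_one_le_exp (1 : ℝ)])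
    _ ≤ (1 / 2) ^ (2 * (d * ((a + 1 + d) * (a + 1 + d - 1)))) :=
        pow_le_pow_of_le_one (by norm_num) (by norm_num) hY
    _ = seedProb d (a + 1 + d) ^ 2 := by
        rw [seedProb, ← pow_mul]
        congr 1
        ring

/-- Properties of the marks that depend on a ball only are measurable. -/
lemma measurableSet_of_agree {s : Set (Site d → ℕ)} (v : Site d) (r : ℕ)
    (h : ∀ β β', Agree 0 v r β β' → β ∈ s → β' ∈ s) : MeasurableSet s := by
  set f : (Site d → ℕ) → Ball d r → ℕ := fun β y => β (v + y.1) with hf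
  have hfm : Measurable f := measurable_pi_lambda _ fun y => measurable_pi_apply _
  have : s = f ⁻¹' (f '' s) := by
    refine Set.Subset.antisymm (Set.subset_preimage_image f s) ?_
    rintro β' ⟨β, hβ, hββ'⟩
    refine h β β' (fun u hu => ?_) hβ
    have := congrFun hββ' ⟨u - v, hu⟩
    simp only [hf, add_sub_cancel] at this
    rw [add_zero, this]
  rw [this]
  exact hfm (Set.to_countable _).measurableSet

/-- The expected number of events of a family that occur, if they all are contained in `H` and at
most `L` of them occur at a time. -/
lemma sum_measure_le {Ω ι : Type*} [MeasurableSpace Ω] (μ : Measure Ω) (F : Finset ι)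
    (E : ι → Set Ω) (H : Set Ω) (hE : ∀ i, MeasurableSet (E i)) (hH : MeasurableSet H)
    (hEH : ∀ i, E i ⊆ H) (G : Ω → Finset ι) (L : ℕ) (hG : ∀ ω i, ω ∈ E i → i ∈ G ω)
    (hL : ∀ ω, (G ω).card ≤ L) : ∑ i ∈ F, μ (E i) ≤ L * μ H := by
  classical
  calc ∑ i ∈ F, μ (E i) = ∑ i ∈ F, ∫⁻ ω, (E i).indicator 1 ω ∂μ :=
        Finset.sum_congr rfl fun i _ => (lintegral_indicator_one (hE i)).symm
    _ = ∫⁻ ω, ∑ i ∈ F, (E i).indicator 1 ω ∂μ :=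
        (lintegral_finsetSum _ fun i _ => measurable_one.indicator (hE i)).symm
    _ ≤ ∫⁻ ω, L * H.indicator 1 ω ∂μ := by
        refine lintegral_mono fun ω => ?_
        by_cases hω : ω ∈ H
        · rw [Set.indicator_of_mem hω, Pi.one_apply, mul_one]
          calc ∑ i ∈ F, (E i).indicator (1 : Ω → ℝ≥0∞) ω
              = ∑ i ∈ F.filter (fun i => ω ∈ E i), 1 := by
                rw [Finset.sum_filter]
                exact Finset.sum_congr rfl fun i _ => by simp [Set.indicator_apply]
            _ = ((F.filter fun i => ω ∈ E i).card : ℝ≥0∞) := by simp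
            _ ≤ L := by
                refine Nat.cast_le.mpr ((Finset.card_le_card fun i hi => ?_).trans (hL ω))
                exact hG ω i (Finset.mem_filter.mp hi).2
        · have : ∀ i ∈ F, (E i).indicator (1 : Ω → ℝ≥0∞) ω = 0 := fun i _ =>
            Set.indicator_of_notMem (fun h => hω (hEH i h)) _
          rw [Finset.sum_eq_zero this]
          exact zero_le
    _ = L * μ H := by
        rw [lintegral_const_mul _ (measurable_one.indicator hH), lintegral_indicator_one hH]

/-- The number of hubs close to a hub, times the length of the paths between them, bounds the
density of the skeleton. -/
lemma iid_skeleton_le_sum (hd : 1 ≤ d) (k : ℕ) :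
    iid d {x | 0 ∈ skeleton (marks x) k} ≤ ∑ w ∈ l1Ball d (joinRadius k),
      pathLen k * iid d {x | 0 ∈ hubs (marks x) k ∧ w ∈ hubs (marks x) k} := by
  set E : Site d → Site d → Set (RandomLabels d) := fun w y =>
    {x | (0 ∈ hubs (marks x) k ∧ w ∈ hubs (marks x) k) ∧ y ∈ hubPath (marks x) k 0 w} with hE
  have hub_meas : ∀ v : Site d, MeasurableSet {x : RandomLabels d | v ∈ hubs (marks x) k} :=
    fun v => measurable_marks hd (measurableSet_of_agree (s := {β | v ∈ hubs β k}) v (scale k)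
      fun β β' h hv => by simpa using h.hubs_iff.mpr hv)
  have path_meas : ∀ w y : Site d,
      MeasurableSet {x : RandomLabels d | y ∈ hubPath (marks x) k 0 w} :=
    fun w y => measurable_marks hd (measurableSet_of_agree (s := {β | y ∈ hubPath β k 0 w}) 0
      (12 * scale k) fun β β' h hv => by simpa using (h.hubPath_iff w y).mpr hv)
  -- if the origin is on the path from `s` to `t`, then `-s` is on the path from `0` to `t - s` in
  -- the translated configuration
  have hcover : {x : RandomLabels d | 0 ∈ skeleton (marks x) k} ⊆
      ⋃ w ∈ l1Ball d (joinRadius k), ⋃ y ∈ l1Ball d (joinRadius k + pathLen k),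
        {x | (fun u => x (-y + u)) ∈ E w y} := by
    rintro x ⟨s, hs, t, ht, hst, h0⟩
    obtain ⟨n, hn, hw⟩ := (hubPath_walk _ k s hs t ht hst).2 0 h0
    have h1 := hw.l1_le
    have h2 := l1_sub_le s t 0
    rw [l1_sub_comm s t] at h2
    simp only [sub_zero] at h1 h2
    simp only [Set.mem_iUnion]
    refine ⟨t - s, by simpa using hst, -s, by rw [mem_l1Ball, l1_neg]; omega, ?_⟩
    have hag : ∀ r v, Agree s v r (marks fun u => x (- -s + u)) (marks x) := fun r v u _ => by
      simp only [marks, neg_neg, add_comm]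
    refine ⟨⟨(hag _ _).hubs_iff.mp (by simpa using hs), (hag _ _).hubs_iff.mp (by simpa using ht)⟩,
      ((hag _ _).hubPath_iff _ _).mp (by simpa using h0)⟩
  refine (measure_mono hcover).trans ((measure_biUnion_finset_le _ _).trans
    (Finset.sum_le_sum fun w _ => (measure_biUnion_finset_le _ _).trans ?_))
  refine (Finset.sum_le_sum fun y _ =>
    iid_reindex_le (-y + ·) (add_right_injective (-y)) (E w y)).trans ?_
  exact sum_measure_le _ _ (E w) _
    (fun y => ((hub_meas 0).inter (hub_meas w)).inter (path_meas w y))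
    ((hub_meas 0).inter (hub_meas w)) (fun y x h => h.1) (fun x => hubPath (marks x) k 0 w) _
    (fun x y h => h.2) fun x => card_hubPath_le _ _ _ _

end

/-! ### The density of the skeletons -/

section
variable {d : ℕ}

lemma marks_of_mem_hubs {β : Site d → ℕ} {k : ℕ} (hk : 1 ≤ k) {v : Site d} (hv : v ∈ hubs β k) :
    k ≤ β v ∨ ∀ w, l1 w ≤ scale k / 2 → β (v + w) < k := by
  obtain ⟨k, rfl⟩ : ∃ j, k = j + 1 := ⟨k - 1, by omega⟩
  exact hv.2

lemma iid_hub_le (hd : 1 ≤ d) {k : ℕ} (hk : 1 ≤ k)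
    (hole : ∀ v : Site d, iid d {x | ∀ w, l1 w ≤ scale k / 2 → marks x (v + w) < k} ≤
      ENNReal.ofReal (seedProb d k ^ 2)) (w : Site d) :
    iid d {x | 0 ∈ hubs (marks x) k ∧ w ∈ hubs (marks x) k} ≤
      ENNReal.ofReal (3 * seedProb d k ^ 2) +
        if w = 0 then ENNReal.ofReal (seedProb d k) else 0 := by
  set p := seedProb d k with hp
  have hp0 : 0 < p := seedProb_pos d k
  have h3 : ENNReal.ofReal (3 * p ^ 2) =
      ENNReal.ofReal (p ^ 2) + ENNReal.ofReal (p ^ 2) + ENNReal.ofReal (p ^ 2) := by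
    rw [← ENNReal.ofReal_add (by positivity) (by positivity),
      ← ENNReal.ofReal_add (by positivity) (by positivity)]
    congr 1
    ring
  split_ifs with hw
  · have hsub : {x : RandomLabels d | 0 ∈ hubs (marks x) k ∧ w ∈ hubs (marks x) k} ⊆
        {x | ∀ w, l1 w ≤ scale k / 2 → marks x (0 + w) < k} ∪ {x | k ≤ marks x 0} :=
      fun x hx => (marks_of_mem_hubs hk hx.1).symm
    refine (measure_mono hsub).trans ((measure_union_le _ _).trans
      (add_le_add ((hole 0).trans ?_) (iid_le_marks hd hk 0).le))
    rw [h3]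
    exact le_add_self
  · have hsub : {x : RandomLabels d | 0 ∈ hubs (marks x) k ∧ w ∈ hubs (marks x) k} ⊆
        ({x | ∀ w, l1 w ≤ scale k / 2 → marks x (0 + w) < k} ∪
          {x | ∀ w', l1 w' ≤ scale k / 2 → marks x (w + w') < k}) ∪
          {x | k ≤ marks x 0 ∧ k ≤ marks x w} := by
      rintro x ⟨h0, h1⟩
      rcases marks_of_mem_hubs hk h0 with h0 | h0
      · rcases marks_of_mem_hubs hk h1 with h1 | h1
        · exact Or.inr ⟨h0, h1⟩
        · exact Or.inl (Or.inr h1)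
      · exact Or.inl (Or.inl h0)
    rw [add_zero, h3]
    exact (measure_mono hsub).trans ((measure_union_le _ _).trans (add_le_add
      ((measure_union_le _ _).trans (add_le_add (hole 0) (hole w)))
      (iid_le_marks_pair hd hk (Ne.symm hw)).le))

lemma cast_scale (k : ℕ) : (scale k : ℝ) = 2 ^ k ^ 2 := by simp [scale]

lemma seedProb_eq (d k : ℕ) : seedProb d k = 2 ^ (d * k) / (scale k : ℝ) ^ d := by
  rw [seedProb, cast_scale, ← pow_mul, one_div, inv_pow, eq_div_iff (by positivity),
    inv_mul_eq_iff_eq_mul₀ (by positivity), ← pow_add]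
  congr 1
  cases k with
  | zero => simp
  | succ k =>
    rw [Nat.add_sub_cancel]
    ring

/-- The density of the skeleton of level `k` is at most `2 ^ O(k)` times the density
`scale k / scale k ^ d` of the path of a hub in a box of side length `scale k`. -/
lemma exists_iid_skeleton_le (hd : 1 ≤ d) : ∃ C : ℕ, 0 < C ∧ ∀ᶠ k : ℕ in atTop, ∀ v : Site d,
    iid d {x | v ∈ skeleton (marks x) k} ≤
      ENNReal.ofReal ((C : ℝ) ^ k / 2 ^ ((d - 1) * k ^ 2)) := by
  refine ⟨8 * 7 ^ d * (3 * 4 ^ d), by positivity, ?_⟩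
  filter_upwards [eventually_iid_hole_le hd, eventually_ge_atTop 1] with k hole hk v
  set p := seedProb d k with hp
  have hp0 : 0 < p := seedProb_pos d k
  set D := joinRadius k
  have hshift : iid d {x | v ∈ skeleton (marks x) k} ≤ iid d {x | 0 ∈ skeleton (marks x) k} := by
    refine le_trans (measure_mono fun x hx => ?_)
      (iid_reindex_le (v + ·) (add_right_injective v) {x | 0 ∈ skeleton (marks x) k})
    have hag : Agree v 0 (9 * pathLen k) (marks fun u => x (v + u)) (marks x) := fun u _ => by
      simp only [marks, add_comm]
    exact hag.skeleton_iff.mp (by simpa using hx)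
  have hsum : iid d {x | 0 ∈ skeleton (marks x) k} ≤
      ENNReal.ofReal (pathLen k * ((2 * D + 1) ^ d * (3 * p ^ 2) + p)) := by
    refine (iid_skeleton_le_sum hd k).trans
      ((Finset.sum_le_sum fun w _ => mul_le_mul_right (iid_hub_le hd hk hole w) _).trans ?_)
    rw [← Finset.mul_sum, Finset.sum_add_distrib, Finset.sum_ite_eq', if_pos (by simp),
      Finset.sum_const, nsmul_eq_mul, ENNReal.ofReal_mul (p := (pathLen k : ℝ)) (by positivity),
      ENNReal.ofReal_natCast, ENNReal.ofReal_add (by positivity) hp0.le,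
      ENNReal.ofReal_mul (p := (2 * (D : ℝ) + 1) ^ d)
        (by positivity)]
    gcongr
    have := card_l1Ball_le d D
    rw [← ENNReal.ofReal_natCast]
    exact ENNReal.ofReal_le_ofReal (by exact_mod_cast this)
  refine hshift.trans (hsum.trans (ENNReal.ofReal_le_ofReal ?_))
  set S : ℝ := (scale k : ℝ) with hS
  have hS1 : 1 ≤ S := by rw [hS]; exact_mod_cast scale_pos k
  have hD : 2 * (D : ℝ) + 1 ≤ 7 * S := by
    have : (D : ℝ) ≤ 3 * S := by rw [hS]; exact_mod_cast joinRadius_le k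
    linarith
  have hL : (pathLen k : ℝ) = 2 * 3 ^ k * S := by simp [pathLen, hS]
  have hpS : p = 2 ^ (d * k) / S ^ d := seedProb_eq d k
  have hS0 : 0 < S := by linarith
  have hSd : S ^ d = S * 2 ^ ((d - 1) * k ^ 2) := by
    obtain ⟨e, rfl⟩ : ∃ e, d = e + 1 := ⟨d - 1, by omega⟩
    rw [Nat.add_sub_cancel, pow_succ, mul_comm e, pow_mul, ← cast_scale, mul_comm]
  have h1 : (2 * (D : ℝ) + 1) ^ d ≤ 7 ^ d * S ^ d := by
    rw [← mul_pow]
    exact pow_le_pow_left₀ (by positivity) hD _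
  have h2 : (2 : ℝ) ^ (d * k) ≤ 7 ^ d * 4 ^ (d * k) := by
    have ha : (2 : ℝ) ^ (d * k) ≤ 4 ^ (d * k) := pow_le_pow_left₀ (by norm_num) (by norm_num) _
    have hb : (1 : ℝ) ≤ 7 ^ d := one_le_pow₀ (by norm_num)
    have hc : (0 : ℝ) ≤ 4 ^ (d * k) := by positivity
    nlinarith
  have h4 : ((2 : ℝ) ^ (d * k)) ^ 2 = 4 ^ (d * k) := by
    rw [← pow_mul, mul_comm _ 2, pow_mul]
    norm_num
  calc (pathLen k : ℝ) * ((2 * D + 1) ^ d * (3 * p ^ 2) + p)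
      ≤ 2 * 3 ^ k * S * (7 ^ d * S ^ d * (3 * p ^ 2) + p) := by rw [hL]; gcongr
    _ = 2 * 3 ^ k * (S / S ^ d) * (7 ^ d * (3 * (2 ^ (d * k)) ^ 2) + 2 ^ (d * k)) := by
        rw [hpS]
        field_simp
    _ ≤ 2 * 3 ^ k * (S / S ^ d) * (7 ^ d * (3 * 4 ^ (d * k)) + 7 ^ d * 4 ^ (d * k)) := by
        rw [h4]
        gcongr
    _ = 8 * 7 ^ d * (3 * 4 ^ d) ^ k * (1 / 2 ^ ((d - 1) * k ^ 2)) := by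
        rw [hSd, mul_pow, ← pow_mul]
        field_simp
        ring
    _ ≤ (8 * 7 ^ d) ^ k * (3 * 4 ^ d) ^ k * (1 / 2 ^ ((d - 1) * k ^ 2)) := by
        gcongr
        refine le_self_pow₀ ?_ (by omega)
        have : (1 : ℝ) ≤ 7 ^ d := one_le_pow₀ (by norm_num)
        linarith
    _ = ((8 * 7 ^ d * (3 * 4 ^ d) : ℕ) : ℝ) ^ k / 2 ^ ((d - 1) * k ^ 2) := by
        push_cast
        rw [mul_pow (8 * 7 ^ d : ℝ), mul_one_div]

/-- Bounds of this form tend to zero. -/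
lemma tendsto_pow_div_two_pow_sq (C : ℕ) {j : ℕ} (hj : 1 ≤ j) :
    Tendsto (fun k : ℕ => (C : ℝ) ^ k / 2 ^ (j * k ^ 2)) atTop (𝓝 0) := by
  have hlim : Tendsto (fun k : ℕ => (1 / 2 : ℝ) ^ k) atTop (𝓝 0) :=
    tendsto_pow_atTop_nhds_zero_of_lt_one (by norm_num) (by norm_num)
  refine squeeze_zero' (Eventually.of_forall fun k => by positivity) ?_ hlim
  filter_upwards [eventually_ge_atTop (C + 1)] with k hk
  have h1 : (C : ℝ) ≤ 2 ^ C := by exact_mod_cast Nat.lt_two_pow_self.le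
  rw [div_le_iff₀ (by positivity), one_div, inv_pow, inv_mul_eq_div, le_div_iff₀ (by positivity)]
  calc (C : ℝ) ^ k * 2 ^ k ≤ (2 ^ C) ^ k * 2 ^ k := by gcongr
    _ = 2 ^ ((C + 1) * k) := by rw [← pow_mul, ← pow_add]; ring_nf
    _ ≤ 2 ^ (j * k ^ 2) := by
        refine pow_le_pow_right₀ (by norm_num) ?_
        rw [sq, ← mul_assoc]
        refine Nat.mul_le_mul_right _ (hk.trans (Nat.le_mul_of_pos_left _ hj))

/-- Almost surely, no vertex is in all skeletons. -/
lemma ae_exists_notMem_skeleton (hd : 2 ≤ d) :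
    ∀ᵐ x ∂(iid d), ∀ v : Site d, ∃ k, v ∉ skeleton (marks x) k := by
  rw [ae_all_iff]
  intro v
  obtain ⟨C, -, hC⟩ := exists_iid_skeleton_le (d := d) (by omega)
  rw [ae_iff]
  refine le_antisymm (ge_of_tendsto
    (f := fun k : ℕ => ENNReal.ofReal ((C : ℝ) ^ k / 2 ^ ((d - 1) * k ^ 2))) ?_
    (hC.mono fun k hk => ?_)) zero_le
  · rw [← ENNReal.ofReal_zero]
    exact ENNReal.tendsto_ofReal (tendsto_pow_div_two_pow_sq C (by omega))
  · refine (measure_mono fun x hx => ?_).trans (hk v)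
    have : ¬ ∃ k, v ∉ skeleton (marks x) k := hx
    push Not at this
    exact this k

lemma exists_iid_not_resolved_le (hd : 1 ≤ d) : ∃ C : ℕ, 0 < C ∧ ∀ᶠ k : ℕ in atTop,
    iid d {x | ¬ Resolved (marks x) k 0} ≤
      ENNReal.ofReal ((C : ℝ) ^ k / 2 ^ ((d - 1) * k ^ 2)) := by
  obtain ⟨C, hC0, hC⟩ := exists_iid_skeleton_le hd
  refine ⟨3 ^ d * C, by positivity, ?_⟩
  filter_upwards [hC, eventually_ge_atTop 1] with k hk hk1
  have hsub : {x : RandomLabels d | ¬ Resolved (marks x) k 0} ⊆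
      ⋃ e ∈ l1Ball d 1, {x | e ∈ skeleton (marks x) k} := by
    intro x hx
    have hx' : ¬ Resolved (marks x) k 0 := hx
    unfold Resolved at hx'
    push Not at hx'
    obtain ⟨e, he, hs⟩ := hx'
    exact Set.mem_biUnion (mem_l1Ball.mpr he) (by simpa using hs)
  refine (measure_mono hsub).trans ((measure_biUnion_finset_le _ _).trans
    ((Finset.sum_le_card_nsmul _ _ _ fun e _ => hk e).trans ?_))
  rw [nsmul_eq_mul, ← ENNReal.ofReal_natCast, ← ENNReal.ofReal_mul (by positivity)]
  refine ENNReal.ofReal_le_ofReal ?_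
  have h1 : ((l1Ball d 1).card : ℝ) ≤ ((3 ^ d : ℕ) : ℝ) ^ k := by
    have h2 : (l1Ball d 1).card ≤ (3 ^ d) ^ k :=
      (card_l1Ball_le d 1).trans (Nat.le_self_pow (by omega) _)
    exact_mod_cast h2
  rw [Nat.cast_mul, mul_pow, mul_div_assoc]
  gcongr

/-! ### The matching algorithm -/

/-- The output of the matching algorithm on a ball with given marks: an output is returned for the
radii `18 * pathLen k` if the centre is resolved at level `k`. (The marks outside the ball, set to
`0` here, then do not matter.) -/
noncomputable def matchRule (r : ℕ) (b : Ball d r → ℕ) : Option (Direction d d) :=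
  open Classical in
  let β : Site d → ℕ := fun u => if h : l1 u ≤ r then b ⟨u, h⟩ else 0
  if h : (layerGrid d d).Adj 0 (matchVec β 0) ∧ ∃ k, r = 18 * pathLen k ∧ Resolved β k 0 then
    some ⟨matchVec β 0, h.1⟩ else none

/-- The uniform local algorithm for perfect matchings of `ℤ^d`. -/
noncomputable def matchAlgorithm (hd : 1 ≤ d) : UniformAlgorithm d (Direction d d) where
  rule r y := matchRule r fun u => mark d (y u)
  measurable_rule r o := by
    have hm : Measurable fun (y : Ball d r → unitInterval) (u : Ball d r) => mark d (y u) :=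
      measurable_pi_lambda _ fun u => (measurable_mark hd).comp (measurable_pi_apply u)
    exact hm (Set.to_countable {b | matchRule r b = o}).measurableSet

lemma matchAlgorithm_rule_eq_some_iff (hd : 1 ≤ d) (x : RandomLabels d) (v : Site d) (r : ℕ)
    (o : Direction d d) : (matchAlgorithm hd).rule r (nbhd id x v r) = some o ↔
      o.1 = matchVec (marks x) v ∧ ∃ k, r = 18 * pathLen k ∧ Resolved (marks x) k v := by
  set β : Site d → ℕ := fun u =>
    if h : l1 u ≤ r then mark d (nbhd id x v r ⟨u, h⟩) else 0 with hβ
  have hag : Agree v 0 r β (marks x) := fun u hu => by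
    rw [sub_zero] at hu
    simp only [hβ, dif_pos hu, nbhd, marks, id, add_comm]
  have hres : ∀ k, r = 18 * pathLen k → (Resolved (marks x) k v ↔ Resolved β k 0) := by
    rintro k rfl
    simpa using hag.resolved_iff
  have hvec : ∀ k, r = 18 * pathLen k → Resolved β k 0 →
      matchVec (marks x) v = matchVec β 0 := by
    rintro k rfl h
    simpa using hag.matchVec_eq h
  classical
  change (if h : (layerGrid d d).Adj 0 (matchVec β 0) ∧
      ∃ k, r = 18 * pathLen k ∧ Resolved β k 0 then
    some (⟨matchVec β 0, h.1⟩ : Direction d d) else none) = some o ↔ _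
  constructor
  · intro h
    by_cases hc : (layerGrid d d).Adj 0 (matchVec β 0) ∧ ∃ k, r = 18 * pathLen k ∧ Resolved β k 0
    · rw [dif_pos hc] at h
      obtain ⟨k, hr, hk⟩ := hc.2
      refine ⟨?_, k, hr, (hres k hr).mpr hk⟩
      rw [hvec k hr hk, ← Option.some.inj h]
    · rw [dif_neg hc] at h
      exact absurd h (by simp)
  · rintro ⟨ho, k, hr, hk⟩
    rw [hres k hr] at hk
    rw [hvec k hr hk] at ho
    rw [dif_pos ⟨ho ▸ o.2, k, hr, hk⟩]
    exact congrArg some (Subtype.ext ho.symm)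

lemma matchAlgorithm_outputs (hd : 1 ≤ d) {x : RandomLabels d} {v : Site d} {o : Direction d d}
    (ho : o.1 = matchVec (marks x) v) {k : ℕ} (hk : Resolved (marks x) k v) :
    (matchAlgorithm hd).codingRadius x v ≤ (18 * pathLen k : ℕ) ∧
      (matchAlgorithm hd).Outputs x v o := by
  have hR : (matchAlgorithm hd).codingRadius x v ≤ (18 * pathLen k : ℕ) := by
    rw [UniformAlgorithm.codingRadius_le_iff]
    refine ⟨_, le_rfl, ?_⟩
    rw [(matchAlgorithm_rule_eq_some_iff hd x v _ o).mpr ⟨ho, k, rfl, hk⟩]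
    simp
  refine ⟨hR, ?_⟩
  obtain ⟨o', r, hr, hro⟩ := UniformAlgorithm.exists_outputs hR
  have h1 := ((matchAlgorithm_rule_eq_some_iff hd x v r o').mp hro).1
  obtain rfl : o' = o := Subtype.ext (h1.trans ho.symm)
  exact ⟨r, hr, hro⟩

lemma layerGrid_adj_zero_iff {l : ℕ} {s : Site d} :
    (layerGrid d l).Adj 0 s ↔ s ≠ 0 ∧ l1 s ≤ 2 ∧ ∀ i : Fin d, l ≤ i.val → s i = 0 := by
  have h : ∑ i, |(0 : Site d) i - s i| ≤ 2 ↔ l1 s ≤ 2 := by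
    unfold l1
    zify
    simp
  change ((0 : Site d) ≠ s ∧ ∑ i, |(0 : Site d) i - s i| ≤ 2) ∧ (∀ i : Fin d, l ≤ i.val →
    (0 : Site d) i = s i) ↔ _
  rw [h, and_assoc]
  simp only [Pi.zero_apply, ne_eq, eq_comm]

lemma matchAlgorithm_solves (hd : 2 ≤ d) :
    (matchAlgorithm (d := d) (by omega)).Solves (diagMatching d) := by
  filter_upwards [ae_exists_notMem_skeleton hd] with x hx
  have hspec := matchVec_spec hx
  refine ⟨fun v => ⟨matchVec (marks x) v, by rw [layerGrid_self]; exact (hspec v).1⟩,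
    fun v => ?_, ?_⟩
  · have hres : ∃ k, Resolved (marks x) k v := by
      choose k hk using fun e => hx (v + e)
      refine ⟨(l1Ball d 1).sup k, fun e he h => hk e ?_⟩
      exact skeleton_antitone _ (Finset.le_sup (mem_l1Ball.mpr he)) h
    obtain ⟨k, hk⟩ := hres
    exact (matchAlgorithm_outputs (by omega) rfl hk).2
  · rw [subgridMatching_isColoring_iff_neg]
    exact fun v => (hspec v).2

lemma exists_matchAlgorithm_iid_le (hd : 2 ≤ d) : ∃ C : ℕ, 0 < C ∧ ∀ᶠ k : ℕ in atTop,
    iid d {x | ((18 * pathLen k : ℕ) : ℕ∞) <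
      (matchAlgorithm (d := d) (by omega)).codingRadius x 0} ≤
      ENNReal.ofReal ((C : ℝ) ^ k / 2 ^ ((d - 1) * k ^ 2)) := by
  obtain ⟨C, hC0, hC⟩ := exists_iid_not_resolved_le (d := d) (by omega)
  refine ⟨C, hC0, hC.mono fun k hk => le_trans (measure_mono_ae ?_) hk⟩
  filter_upwards [ae_exists_notMem_skeleton hd] with x hx hlt hres
  have h0 : (layerGrid d d).Adj 0 (matchVec (marks x) 0) := by
    rw [layerGrid_self]
    exact (matchVec_spec hx 0).1
  exact absurd hlt (not_lt.mpr (matchAlgorithm_outputs (by omega) (o := ⟨_, h0⟩) rfl hres).1)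

end

/-! ### Algorithms on the layers -/

section
variable {d l : ℕ}

/-- The inclusion of `ℤ^l` into `ℤ^d` as the first `l` coordinates. -/
def incl (l d : ℕ) (u : Site l) : Site d := fun i => if h : i.val < l then u ⟨i.val, h⟩ else 0

lemma incl_add (u v : Site l) : incl l d (u + v) = incl l d u + incl l d v := by
  ext i
  by_cases h : i.val < l <;> simp [incl, h]

lemma incl_zero : incl l d 0 = 0 := by
  ext i
  simp [incl]

lemma incl_neg (u : Site l) : incl l d (-u) = -incl l d u := by
  rw [eq_neg_iff_add_eq_zero, ← incl_add, neg_add_cancel, incl_zero]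

lemma incl_injective (h : l ≤ d) : Function.Injective (incl l d) := by
  intro u v huv
  ext i
  simpa [incl] using congrFun huv (Fin.castLE h i)

lemma l1_incl (h : l ≤ d) (u : Site l) : l1 (incl l d u) = l1 u := by
  unfold l1
  refine (Finset.sum_of_injOn (Fin.castLE h) (Fin.castLE_injective h).injOn (by simp) ?_ ?_).symm
  · intro i _ hi
    have : ¬ i.val < l := fun hlt => hi ⟨⟨i.val, hlt⟩, by simp, rfl⟩
    simp [incl, this]
  · intro i _
    simp [incl]

/-- A direction in `ℤ^l` as a direction in the layers of `ℤ^d`. -/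
def Direction.lift (h : l ≤ d) (s : Direction l l) : Direction d l :=
  ⟨incl l d s.1, by
    rw [layerGrid_adj_zero_iff, l1_incl h]
    obtain ⟨h1, h2, -⟩ := layerGrid_adj_zero_iff.mp s.2
    refine ⟨fun h0 => h1 (incl_injective h (h0.trans incl_zero.symm)), h2, fun i hi => ?_⟩
    simp [incl, not_lt.mpr hi]⟩

/-- An algorithm for `ℤ^l`, applied in each layer of `ℤ^d`. -/
def layerAlgorithm (h : l ≤ d) (A : UniformAlgorithm l (Direction l l)) :
    UniformAlgorithm d (Direction d l) where
  rule r y := (A.rule r fun u => y ⟨incl l d u.1, (l1_incl h u.1).trans_le u.2⟩).map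
    (Direction.lift h)
  measurable_rule r o := by
    have hm : Measurable fun (y : Ball d r → unitInterval) (u : Ball l r) =>
        y ⟨incl l d u.1, (l1_incl h u.1).trans_le u.2⟩ :=
      measurable_pi_lambda _ fun u => measurable_pi_apply _
    have hs : MeasurableSet {z | (A.rule r z).map (Direction.lift h) = o} := by
      have : {z | (A.rule r z).map (Direction.lift h) = o} =
          ⋃ o' ∈ {o' : Option (Direction l l) | o'.map (Direction.lift h) = o},
            {z | A.rule r z = o'} := by
        ext z
        simp
      rw [this]
      exact MeasurableSet.biUnion (Set.to_countable _) fun o' _ => A.measurable_rule r o'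
    exact hm hs

variable (h : l ≤ d) (A : UniformAlgorithm l (Direction l l))

lemma layerAlgorithm_rule (x : RandomLabels d) (v : Site d) (r : ℕ) :
    (layerAlgorithm h A).rule r (nbhd id x v r) =
      (A.rule r (nbhd id (fun u => x (v + incl l d u)) 0 r)).map (Direction.lift h) := by
  simp only [layerAlgorithm]
  congr 2
  funext u
  simp [nbhd]

lemma layerAlgorithm_codingRadius (x : RandomLabels d) (v : Site d) :
    (layerAlgorithm h A).codingRadius x v = A.codingRadius (fun u => x (v + incl l d u)) 0 := by
  simp [UniformAlgorithm.codingRadius, layerAlgorithm_rule]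

lemma layerAlgorithm_outputs {x : RandomLabels d} {v : Site d} {o : Direction l l}
    (ho : A.Outputs (fun u => x (v + incl l d u)) 0 o) :
    (layerAlgorithm h A).Outputs x v (o.lift h) := by
  obtain ⟨r, hr, hro⟩ := ho
  exact ⟨r, by rw [layerAlgorithm_codingRadius, hr], by rw [layerAlgorithm_rule, hro]; rfl⟩

lemma layerAlgorithm_solves (hA : A.Solves (diagMatching l)) :
    (layerAlgorithm h A).Solves (subgridMatching d l) := by
  have hae : ∀ᵐ x ∂(iid d), ∀ v : Site d, ∃ c : Site l → Direction l l,
      (∀ u, A.Outputs (fun u => x (v + incl l d u)) u (c u)) ∧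
      (diagMatching l).IsColoring id c := by
    rw [ae_all_iff]
    intro v
    exact (measurePreserving_reindex (fun u => v + incl l d u)
      ((add_right_injective v).comp (incl_injective h))).quasiMeasurePreserving.ae hA
  filter_upwards [hae] with x hx
  choose c hc hcol using hx
  refine ⟨fun v => (c v 0).lift h, fun v => layerAlgorithm_outputs h A (hc v 0), ?_⟩
  rw [subgridMatching_isColoring_iff_neg]
  intro v
  have hcv := (subgridMatching_isColoring_iff_neg _).mp (hcol v) 0
  rw [zero_add] at hcv
  -- the neighbour sees the same layer, shifted
  have hnext : c (v + incl l d (c v 0).1) 0 = c v (c v 0).1 := by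
    refine UniformAlgorithm.Outputs.unique (hc _ 0) ?_
    have := (UniformAlgorithm.outputs_shift (A := A) (fun u => x (v + incl l d u)) (c v 0).1 0
      (c v (c v 0).1)).mpr (by simpa using hc v (c v 0).1)
    simpa only [incl_add, add_assoc] using this
  change incl l d (c (v + incl l d (c v 0).1) 0).1 = -incl l d (c v 0).1
  rw [hnext, hcv, incl_neg]

end

/-- Perfect matchings of the layers: the coding radius takes the values `18 * pathLen k` only, and
it exceeds them with probability at most `2 ^ (-(l - 1) k² + O(k))`. -/
theorem exists_layer_algorithm {d l : ℕ} (hl : 2 ≤ l) (hld : l ≤ d) :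
    ∃ A : UniformAlgorithm d (Direction d l), A.Solves (subgridMatching d l) ∧
      (∀ x (r : ℕ), A.codingRadius x 0 = r → ∃ k, r = 18 * pathLen k) ∧
      ∃ C : ℕ, 0 < C ∧ ∀ᶠ k : ℕ in atTop,
        iid d {x | ((18 * pathLen k : ℕ) : ℕ∞) < A.codingRadius x 0} ≤
          ENNReal.ofReal ((C : ℝ) ^ k / 2 ^ ((l - 1) * k ^ 2)) := by
  obtain ⟨C, hC0, hC⟩ := exists_matchAlgorithm_iid_le hl
  refine ⟨layerAlgorithm hld (matchAlgorithm (by omega)),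
    layerAlgorithm_solves hld _ (matchAlgorithm_solves hl), fun x r hr => ?_, C, hC0,
    hC.mono fun k hk => ?_⟩
  · rw [layerAlgorithm_codingRadius] at hr
    obtain ⟨o, r', hr', ho⟩ := UniformAlgorithm.exists_outputs hr.le
    obtain rfl : r = r' := by exact_mod_cast hr.symm.trans hr'
    obtain ⟨-, k, hk, -⟩ := (matchAlgorithm_rule_eq_some_iff _ _ _ _ _).mp ho
    exact ⟨k, hk⟩
  · refine le_trans (measure_mono fun x hx => ?_) ((iid_reindex_le (fun u => 0 + incl l d u)
      ((add_right_injective 0).comp (incl_injective hld)) _).trans hk)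
    simp only [Set.mem_ofPred_eq, layerAlgorithm_codingRadius] at hx
    exact hx

/-! ### Complexities and moments -/

lemma tendsto_logb_one_div : Tendsto (fun ε : ℝ => Real.logb 2 (1 / ε)) (𝓝[>] 0) atTop := by
  simp only [one_div]
  exact (Real.tendsto_logb_atTop one_lt_two).comp tendsto_inv_nhdsGT_zero

lemma eighteen_mul_pathLen_le (k : ℕ) : 18 * pathLen k ≤ 2 ^ (k ^ 2 + 2 * k + 6) := by
  unfold pathLen scale
  calc 18 * (2 * 3 ^ k * 2 ^ k ^ 2) ≤ 64 * (4 ^ k * 2 ^ k ^ 2) := by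
        have : 3 ^ k ≤ 4 ^ k := Nat.pow_le_pow_left (by omega) k
        nlinarith [Nat.mul_le_mul_right (2 ^ k ^ 2) this, Nat.zero_le (4 ^ k * 2 ^ k ^ 2)]
    _ = 2 ^ (k ^ 2 + 2 * k + 6) := by
        rw [show (4 : ℕ) = 2 ^ 2 by norm_num, ← pow_mul]
        ring

lemma pow_div_two_pow_le (C j k : ℕ) :
    (C : ℝ) ^ k / 2 ^ (j * k ^ 2) ≤ 2 ^ ((C : ℝ) * k - j * (k : ℝ) ^ 2) := by
  have h : (C : ℝ) ≤ 2 ^ C := by exact_mod_cast Nat.lt_two_pow_self.le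
  have h1 : (C : ℝ) * k = ((C * k : ℕ) : ℝ) := by push_cast; rfl
  have h2 : j * (k : ℝ) ^ 2 = ((j * k ^ 2 : ℕ) : ℝ) := by push_cast; rfl
  rw [Real.rpow_sub two_pos, h1, h2, Real.rpow_natCast, Real.rpow_natCast, pow_mul 2 C k]
  gcongr

section
variable {d : ℕ} {Out : Type} {A : UniformAlgorithm d Out} {C j : ℕ}

/-- Given tails `2 ^ (-j k² + O(k))` at the radii `2 ^ (k² + O(k))`, the level `k` is chosen
slightly larger than `√(log (1/ε) / j)`. -/
lemma exists_hasComplexity (hj : 1 ≤ j)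
    (hA : ∀ᶠ k : ℕ in atTop, iid d {x | ((18 * pathLen k : ℕ) : ℕ∞) < A.codingRadius x 0} ≤
      ENNReal.ofReal ((C : ℝ) ^ k / 2 ^ (j * k ^ 2))) :
    ∃ c : ℝ, A.HasComplexity
      (fun ε => (1 / ε) ^ (1 / (j : ℝ)) * 2 ^ (c * √(Real.logb 2 (1 / ε)))) := by
  obtain ⟨K, hK⟩ := eventually_atTop.mp hA
  have hj0 : (1 : ℝ) ≤ j := by exact_mod_cast hj
  refine ⟨2 * (C + 1) + 2 + (2 * (C + 1) + 6 + (C + 1) ^ 2), ?_⟩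
  filter_upwards [tendsto_logb_one_div.eventually_ge_atTop (max 1 (j * (K : ℝ) ^ 2)),
    self_mem_nhdsWithin] with ε hx hε
  have hε0 : 0 < ε := hε
  set X := Real.logb 2 (1 / ε) with hX
  have hX1 : 1 ≤ X := (le_max_left _ _).trans hx
  have h2X : (2 : ℝ) ^ X = 1 / ε := Real.rpow_logb two_pos (by norm_num) (by positivity)
  set y := √(X / j) with hy
  have hy0 : 0 ≤ y := Real.sqrt_nonneg _
  have hysq : y ^ 2 = X / j := Real.sq_sqrt (by positivity)
  have hyX : y ≤ √X := Real.sqrt_le_sqrt (div_le_self (by linarith) hj0)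
  have h1X : 1 ≤ √X := Real.one_le_sqrt.mpr hX1
  have hKy : (K : ℝ) ≤ y := by
    refine Real.le_sqrt_of_sq_le ?_
    rw [le_div_iff₀ (by linarith), mul_comm]
    exact (le_max_right _ _).trans hx
  set k := ⌈y⌉₊ + C with hk
  have hk1 : y + C ≤ k := by
    rw [hk, Nat.cast_add]
    linarith [Nat.le_ceil y]
  have hk2 : (k : ℝ) ≤ y + (C + 1) := by
    rw [hk, Nat.cast_add]
    linarith [Nat.ceil_lt_add_one hy0]
  have hKk : K ≤ k := by
    have : (K : ℝ) ≤ k := by linarith [Nat.cast_nonneg (α := ℝ) C]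
    exact_mod_cast this
  have hprob : (C : ℝ) ^ k / 2 ^ (j * k ^ 2) ≤ ε := by
    refine (pow_div_two_pow_le C j k).trans ?_
    have : (2 : ℝ) ^ (-X) = ε := by rw [Real.rpow_neg two_pos.le, h2X, one_div, inv_inv]
    rw [← this]
    refine Real.rpow_le_rpow_of_exponent_le one_le_two ?_
    have hC0 : (0 : ℝ) ≤ C := Nat.cast_nonneg C
    have h1 : j * y ≤ j * (k : ℝ) - C := by nlinarith
    have h2 : y * (j * y) ≤ k * (j * (k : ℝ) - C) :=
      mul_le_mul (by linarith) h1 (by positivity) (by positivity)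
    have h3 : y * (j * y) = X := by
      rw [show y * (j * y) = j * y ^ 2 by ring, hysq]
      field_simp
    nlinarith
  have hrad : ((18 * pathLen k : ℕ) : ℝ) ≤ (1 / ε) ^ (1 / (j : ℝ)) *
      2 ^ ((2 * ((C : ℝ) + 1) + 2 + (2 * (C + 1) + 6 + (C + 1) ^ 2)) * √X) := by
    have h1 : ((18 * pathLen k : ℕ) : ℝ) ≤ 2 ^ ((k : ℝ) ^ 2 + 2 * k + 6) := by
      have h := eighteen_mul_pathLen_le k
      have : ((k : ℝ) ^ 2 + 2 * k + 6) = ((k ^ 2 + 2 * k + 6 : ℕ) : ℝ) := by push_cast; ring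
      rw [this, Real.rpow_natCast]
      exact_mod_cast h
    refine h1.trans ?_
    rw [← h2X, ← Real.rpow_mul two_pos.le, ← Real.rpow_add two_pos]
    refine Real.rpow_le_rpow_of_exponent_le one_le_two ?_
    have hC0 : (0 : ℝ) ≤ C := Nat.cast_nonneg C
    have h2 : (k : ℝ) ^ 2 ≤ (y + (C + 1)) ^ 2 := pow_le_pow_left₀ (by positivity) hk2 2
    have h3 : (k : ℝ) ^ 2 + 2 * k + 6 ≤
        X / j + (2 * (C + 1) + 2) * y + (2 * (C + 1) + 6 + (C + 1) ^ 2) := by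
      rw [← hysq]
      nlinarith
    have h4 : (2 * ((C : ℝ) + 1) + 2) * y ≤ (2 * (C + 1) + 2) * √X := by gcongr
    have h5 : (2 * ((C : ℝ) + 1) + 6 + (C + 1) ^ 2) ≤ (2 * (C + 1) + 6 + (C + 1) ^ 2) * √X :=
      le_mul_of_one_le_right (by positivity) h1X
    rw [mul_one_div]
    linarith
  refine (measure_mono fun x hx' => ?_).trans
    ((hK k hKk).trans (ENNReal.ofReal_le_ofReal hprob))
  have hlt : ENNReal.ofReal _ < (A.codingRadius x 0 : ℝ≥0∞) := hx'
  have := (ENNReal.ofReal_le_ofReal hrad).trans_lt hlt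
  rw [ENNReal.ofReal_natCast, ← ENat.toENNReal_coe, ENat.toENNReal_lt] at this
  exact this

/-- A factor `2 ^ O(√(log (1/ε)))` is a change of `o(1)` in the exponent. -/
lemma exists_tendsto_exponent (hj : 1 ≤ j) {c : ℝ}
    (hA : A.HasComplexity (fun ε => (1 / ε) ^ (1 / (j : ℝ)) * 2 ^ (c * √(Real.logb 2 (1 / ε))))) :
    ∃ δ : ℝ → ℝ, Tendsto δ (𝓝[>] 0) (𝓝 0) ∧
      A.HasComplexity (fun ε => (1 / ε) ^ (1 / ((j : ℝ) - δ ε))) := by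
  have hj0 : (j : ℝ) ≠ 0 := by positivity
  refine ⟨fun ε => j - 1 / (1 / j + c / √(Real.logb 2 (1 / ε))), ?_, ?_⟩
  · have h1 : Tendsto (fun ε : ℝ => c / √(Real.logb 2 (1 / ε))) (𝓝[>] 0) (𝓝 0) :=
      (Real.tendsto_sqrt_atTop.comp tendsto_logb_one_div).const_div_atTop c
    have h2 : Tendsto (fun ε : ℝ => (j : ℝ) - 1 / (1 / j + c / √(Real.logb 2 (1 / ε)))) (𝓝[>] 0)
        (𝓝 ((j : ℝ) - 1 / (1 / j + 0))) :=
      (tendsto_const_nhds.div (h1.const_add (1 / (j : ℝ))) (by simpa using hj0)).const_sub _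
    simpa using h2
  · filter_upwards [hA, tendsto_logb_one_div.eventually_gt_atTop 0, self_mem_nhdsWithin]
      with ε h hX hε
    have hε0 : 0 < ε := hε
    convert h using 5
    set X := Real.logb 2 (1 / ε) with hXdef
    have h2X : (2 : ℝ) ^ X = 1 / ε := Real.rpow_logb two_pos (by norm_num) (by positivity)
    rw [sub_sub_cancel, one_div_one_div, ← h2X, ← Real.rpow_mul two_pos.le,
      ← Real.rpow_mul two_pos.le, ← Real.rpow_add two_pos]
    congr 1
    have : X / √X = √X := Real.div_sqrt
    rw [mul_add, mul_div_left_comm X c, this]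

lemma tsum_lt_top_of_forall_eventually_le {f : ℕ → ℝ≥0∞} {ρ : ℕ → ℕ} (hfin : ∀ r, f r ≠ ∞)
    (h0 : ∀ r, (∀ k, r ≠ ρ k) → f r = 0)
    (hterm : ∀ᶠ k in atTop, f (ρ (k + 1)) ≤ ENNReal.ofReal ((1 / 2) ^ k)) :
    ∑' r, f r < ∞ := by
  have hle : ∑' r, f r ≤ ∑' k, f (ρ k) := by
    calc ∑' r, f r ≤ ∑' r, ∑' k, if r = ρ k then f (ρ k) else 0 := by
          refine ENNReal.tsum_le_tsum fun r => ?_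
          by_cases h : ∃ k, r = ρ k
          · obtain ⟨k, rfl⟩ := h
            refine le_trans ?_ (ENNReal.le_tsum k)
            rw [if_pos rfl]
          · rw [h0 r fun k hk => h ⟨k, hk⟩]
            exact zero_le
      _ = ∑' k, f (ρ k) := by
          rw [ENNReal.tsum_comm]
          exact tsum_congr fun k => tsum_ite_eq (ρ k) _
  refine hle.trans_lt ?_
  obtain ⟨K, hK⟩ := eventually_atTop.mp hterm
  rw [← ENNReal.summable.sum_add_tsum_nat_add' (k := K + 1)]
  refine ENNReal.add_lt_top.mpr ⟨ENNReal.sum_lt_top.mpr fun k _ => (hfin _).lt_top, ?_⟩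
  have hgeo : Summable fun k : ℕ => (1 / 2 : ℝ) ^ (k + K) :=
    (summable_nat_add_iff K).mpr (summable_geometric_of_lt_one (by norm_num) (by norm_num))
  refine lt_of_le_of_lt (ENNReal.tsum_le_tsum fun k => ?_)
    (lt_top_iff_ne_top.mpr hgeo.tsum_ofReal_ne_top)
  exact hK (k + K) (by omega)

/-- Moments of order less than `j` are finite: the radii grow faster than geometrically. -/
lemma moment_lt_top {α : ℝ≥0} (hα : α < j)
    (hR : ∀ x (r : ℕ), A.codingRadius x 0 = r → ∃ k, r = 18 * pathLen k)
    (hA : ∀ᶠ k : ℕ in atTop, iid d {x | ((18 * pathLen k : ℕ) : ℕ∞) < A.codingRadius x 0} ≤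
      ENNReal.ofReal ((C : ℝ) ^ k / 2 ^ (j * k ^ 2))) :
    A.moment α < ∞ := by
  refine tsum_lt_top_of_forall_eventually_le (ρ := fun k => 18 * pathLen k)
    (fun r => ENNReal.mul_ne_top
      (ENNReal.rpow_ne_top_of_nonneg (NNReal.coe_nonneg α) (ENNReal.natCast_ne_top r))
      (measure_ne_top _ _)) (fun r hr => ?_) ?_
  · have : {x | A.codingRadius x 0 = r} = ∅ :=
      Set.eq_empty_of_forall_notMem fun x hx => (hR x r hx).elim hr
    rw [this, measure_empty, mul_zero]
  have hαr : (α : ℝ) < j := by exact_mod_cast hα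
  obtain ⟨K₁, hK₁⟩ := exists_nat_gt ((13 * (α : ℝ) + C + 1) / (j - α))
  filter_upwards [hA, eventually_ge_atTop K₁, eventually_ge_atTop 1] with k hk hkK hk1
  have hk1r : (1 : ℝ) ≤ k := by exact_mod_cast hk1
  have h1 : iid d {x | A.codingRadius x 0 = (18 * pathLen (k + 1) : ℕ)} ≤
      ENNReal.ofReal (2 ^ ((C : ℝ) * k - j * (k : ℝ) ^ 2)) := by
    refine le_trans (measure_mono fun x hx => ?_)
      (hk.trans (ENNReal.ofReal_le_ofReal (pow_div_two_pow_le C j k)))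
    have hx' : A.codingRadius x 0 = (18 * pathLen (k + 1) : ℕ) := hx
    change ((18 * pathLen k : ℕ) : ℕ∞) < A.codingRadius x 0
    rw [hx']
    have := six_mul_pathLen_le k
    have := two_le_pathLen k
    exact_mod_cast (by omega : 18 * pathLen k < 18 * pathLen (k + 1))
  have h2 : ((18 * pathLen (k + 1) : ℕ) : ℝ≥0∞) ^ (α : ℝ) ≤
      ENNReal.ofReal (2 ^ (((k : ℝ) ^ 2 + 4 * k + 9) * α)) := by
    rw [Real.rpow_mul two_pos.le, ← ENNReal.ofReal_rpow_of_nonneg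
      (x := (2 : ℝ) ^ ((k : ℝ) ^ 2 + 4 * k + 9)) (by positivity) (NNReal.coe_nonneg α)]
    refine ENNReal.rpow_le_rpow ?_ (NNReal.coe_nonneg α)
    rw [← ENNReal.ofReal_natCast]
    refine ENNReal.ofReal_le_ofReal ?_
    have h := eighteen_mul_pathLen_le (k + 1)
    rw [show ((k : ℝ) ^ 2 + 4 * k + 9) = ((((k + 1) ^ 2 + 2 * (k + 1) + 6 : ℕ)) : ℝ) by
      push_cast; ring, Real.rpow_natCast]
    exact_mod_cast h
  refine (mul_le_mul' h2 h1).trans ?_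
  rw [← ENNReal.ofReal_mul (by positivity), ← Real.rpow_add two_pos]
  refine ENNReal.ofReal_le_ofReal ?_
  have hhalf : (1 / 2 : ℝ) ^ k = 2 ^ (-(k : ℝ)) := by
    rw [Real.rpow_neg two_pos.le, Real.rpow_natCast, one_div, inv_pow]
  rw [hhalf]
  refine Real.rpow_le_rpow_of_exponent_le one_le_two ?_
  have h3 : 13 * (α : ℝ) + C + 1 ≤ k * (j - α) := by
    rw [div_lt_iff₀ (by linarith)] at hK₁
    have : (K₁ : ℝ) ≤ k := by exact_mod_cast hkK
    nlinarith
  have h4 : (13 * (α : ℝ) + C + 1) * k ≤ k * (j - α) * k := by gcongr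
  have h5 : (α : ℝ) ≤ α * k := le_mul_of_one_le_right (NNReal.coe_nonneg α) hk1r
  nlinarith

/-- Markov's inequality: a finite moment of order `α` gives the uniform complexity
`O((1/ε)^(1/α))`. -/
lemma hasComplexity_of_moment {α : ℝ≥0} (hα : 0 < α) (hm : A.moment α < ∞)
    (hR : ∀ᵐ x ∂(iid d), A.codingRadius x 0 ≠ ⊤) :
    A.HasComplexity (fun ε => (((A.moment α).toReal + 1) / ε) ^ (1 / (α : ℝ))) := by
  filter_upwards [self_mem_nhdsWithin] with ε hε
  have hε0 : 0 < ε := hε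
  set M := (A.moment α).toReal with hM
  have hM0 : 0 ≤ M := ENNReal.toReal_nonneg
  set t := ((M + 1) / ε) ^ (1 / (α : ℝ)) with ht
  have ht0 : 0 < t := Real.rpow_pos_of_pos (by positivity) _
  have hα0 : (0 : ℝ) < α := hα
  have htα : t ^ (α : ℝ) = (M + 1) / ε := by
    rw [ht, ← Real.rpow_mul (by positivity), one_div_mul_cancel hα0.ne', Real.rpow_one]
  have hsum : iid d {x | ENNReal.ofReal t < (A.codingRadius x 0 : ℝ≥0∞)} ≤
      ∑' r : ℕ, if t < r then iid d {x | A.codingRadius x 0 = r} else 0 := by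
    have hsub : iid d {x | ENNReal.ofReal t < (A.codingRadius x 0 : ℝ≥0∞)} ≤
        iid d (⋃ r : ℕ, {x | t < r ∧ A.codingRadius x 0 = r}) := by
      refine measure_mono_ae ?_
      filter_upwards [hR] with x hx hlt
      obtain ⟨r, hr⟩ := ENat.ne_top_iff_exists.mp hx
      have hlt' : ENNReal.ofReal t < (A.codingRadius x 0 : ℝ≥0∞) := hlt
      rw [← hr, ENat.toENNReal_coe, ENNReal.ofReal_lt_natCast] at hlt'
      · exact Set.mem_iUnion.mpr ⟨r, hlt', hr.symm⟩
      · rintro rfl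
        simp at hlt'
    refine hsub.trans ((measure_iUnion_le _).trans (ENNReal.tsum_le_tsum fun r => ?_))
    split_ifs with h
    · exact measure_mono fun x hx => hx.2
    · simp [h]
  have hmul : ENNReal.ofReal (t ^ (α : ℝ)) *
      (∑' r : ℕ, if t < r then iid d {x | A.codingRadius x 0 = r} else 0) ≤ A.moment α := by
    rw [← ENNReal.tsum_mul_left]
    refine ENNReal.tsum_le_tsum fun r => ?_
    split_ifs with h
    · gcongr
      rw [← ENNReal.ofReal_rpow_of_nonneg ht0.le hα0.le, ← ENNReal.ofReal_natCast]
      exact ENNReal.rpow_le_rpow (ENNReal.ofReal_le_ofReal h.le) hα0.le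
    · simp
  refine hsum.trans ?_
  rw [htα] at hmul
  have hpos : 0 < (M + 1) / ε := by positivity
  have hne : ENNReal.ofReal ((M + 1) / ε) ≠ 0 := by simpa using hpos
  rw [← ENNReal.ofReal_toReal hm.ne, mul_comm, ← ENNReal.le_div_iff_mul_le (Or.inl hne)
    (Or.inl ENNReal.ofReal_ne_top), ← ENNReal.ofReal_div_of_pos hpos] at hmul
  refine hmul.trans (ENNReal.ofReal_le_ofReal ?_)
  rw [← hM, div_div_eq_mul_div, div_le_iff₀ (by linarith), mul_comm]
  nlinarith

end

lemma isLittleO_rpow_one_div {a b K : ℝ} (hab : a < b) (hK : 0 ≤ K) :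
    (fun ε : ℝ => (K / ε) ^ a) =o[𝓝[>] 0] fun ε => (1 / ε) ^ b := by
  have h1 : (fun y : ℝ => y ^ a) =o[atTop] fun y => y ^ b := by
    rw [isLittleO_iff_tendsto']
    · have : Tendsto (fun y : ℝ => y ^ (-(b - a))) atTop (𝓝 0) :=
        tendsto_rpow_neg_atTop (by linarith)
      refine this.congr' ?_
      filter_upwards [eventually_gt_atTop 0] with y hy
      rw [← Real.rpow_sub hy]
      congr 1
      ring
    · filter_upwards [eventually_gt_atTop 0] with y hy h
      exact absurd h (Real.rpow_pos_of_pos hy _).ne'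
  have h2 := (h1.comp_tendsto tendsto_inv_nhdsGT_zero).const_mul_left (K ^ a)
  refine h2.congr' ?_ ?_
  · filter_upwards [self_mem_nhdsWithin] with ε hε
    have hε0 : (0 : ℝ) < ε := hε
    rw [div_eq_mul_inv, Real.mul_rpow hK (inv_nonneg.mpr hε0.le)]
    rfl
  · filter_upwards with ε
    simp

/-- The moment exponent of the matching problem on the layers of dimension `j + 1`. -/
theorem momentExponent_subgridMatching (d j : ℕ) (hj : 1 ≤ j) (hjd : j + 1 ≤ d) :
    momentExponent (subgridMatching d (j + 1)) = j := by
  refine le_antisymm (iSup₂_le fun α hα => ?_) ?_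
  · obtain ⟨A, hA, hm⟩ := hα
    by_contra hlt
    have hjα : (j : ℝ) < α := by
      have : (j : ℝ≥0∞) < α := not_le.mp hlt
      exact_mod_cast this
    have hj0 : (0 : ℝ) < j := by exact_mod_cast hj
    have hR : ∀ᵐ x ∂(iid d), A.codingRadius x 0 ≠ ⊤ := by
      filter_upwards [hA] with x hx
      obtain ⟨c, hc, -⟩ := hx
      obtain ⟨r, hr, -⟩ := hc 0
      rw [hr]
      exact ENat.natCast_ne_top r
    exact not_inULOCALLittleO_subgridMatching d j hj hjd
      ⟨_, isLittleO_rpow_one_div (one_div_lt_one_div_of_lt hj0 hjα)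
        (by have := ENNReal.toReal_nonneg (a := A.moment α); linarith), A, hA,
        hasComplexity_of_moment (hj0.trans hjα) hm hR⟩
  · obtain ⟨A, hA, hR, C, -, hC⟩ := exists_layer_algorithm (l := j + 1) (by omega) hjd
    refine ENNReal.le_of_forall_nnreal_lt fun α hα => ?_
    have hα' : α < j := by exact_mod_cast hα
    exact le_iSup₂_of_le α ⟨A, hA, moment_lt_top hα' hR hC⟩ le_rfl

/-- Perfect matching in `ℤ^d` with added diagonal edges, and on its lower-dimensional sub-grids. -/
theorem theorem6p2 (d : ℕ) (hd : 2 ≤ d) :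
    -- the problem is not in `LOCAL(O(log* n))`
    (∀ (K : ℝ) (c : ℕ), 1 ≤ K → 1 ≤ c → ¬ InLOCAL (diagMatching d) K c logStar) ∧
    -- nor in `ULOCAL(o((1/ε)^{1/(d-1)}))`
    ¬ InULOCALLittleO (diagMatching d) (fun ε => (1 / ε) ^ (1 / ((d : ℝ) - 1))) ∧
    -- it has a uniform local algorithm of complexity `(1/ε)^{1/(d-1)} 2^{O(√(log 1/ε))}`
    (∃ C : ℝ, InULOCAL (diagMatching d)
      (fun ε => (1 / ε) ^ (1 / ((d : ℝ) - 1)) * 2 ^ (C * √(Real.logb 2 (1 / ε))))) ∧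
    -- on the sub-grids of dimension `j + 1` the complexity is `(1/ε)^{1/(j-o(1))}`, and `M = j`
    ∀ j : ℕ, 1 ≤ j → j ≤ d - 1 →
      (∃ δ : ℝ → ℝ, Tendsto δ (𝓝[>] 0) (𝓝 0) ∧
        InULOCAL (subgridMatching d (j + 1)) (fun ε => (1 / ε) ^ (1 / ((j : ℝ) - δ ε)))) ∧
      ¬ InULOCALLittleO (subgridMatching d (j + 1)) (fun ε => (1 / ε) ^ (1 / (j : ℝ))) ∧
      momentExponent (subgridMatching d (j + 1)) = j := by
  refine ⟨fun K c hK hc => not_inLOCAL_diagMatching d (by omega) K c hK hc logStar, ?_, ?_,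
    fun j hj hjd => ⟨?_, not_inULOCALLittleO_subgridMatching d j hj (by omega),
      momentExponent_subgridMatching d j hj (by omega)⟩⟩
  · obtain ⟨j, rfl⟩ : ∃ j, d = j + 1 := ⟨d - 1, by omega⟩
    have := not_inULOCALLittleO_subgridMatching (j + 1) j (by omega) le_rfl
    rwa [Nat.cast_add, Nat.cast_one, add_sub_cancel_right]
  · obtain ⟨j, rfl⟩ : ∃ j, d = j + 1 := ⟨d - 1, by omega⟩
    obtain ⟨A, hA, -, C, -, hC⟩ := exists_layer_algorithm (d := j + 1) hd le_rfl
    rw [Nat.cast_add, Nat.cast_one, add_sub_cancel_right]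
    obtain ⟨c, hc⟩ := exists_hasComplexity (j := j) (by omega) hC
    exact ⟨c, A, hA, hc⟩
  · obtain ⟨A, hA, -, C, -, hC⟩ := exists_layer_algorithm (d := d) (l := j + 1) (by omega)
      (by omega)
    obtain ⟨c, hc⟩ := exists_hasComplexity hj hC
    obtain ⟨δ, hδ, hδA⟩ := exists_tendsto_exponent hj hc
    exact ⟨δ, hδ, A, hA, hδA⟩
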